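/- Let $E$ be a real separable Banach space (in particular $E=\mathbb R^d$) and let $ID$ be the set of infinitely divisible Borel probability measures on $E$. For $\nu\in ID$ let $Y_\nu$ be a Lévy process in $E$ (stationary independent increments, $Y_\nu(0)=0$, càdlàg paths) such that $Y_\nu(1)$ has law $\nu$, and for $\beta>0$ put $$\mathcal J^\beta(\nu):=\mathcal L\Big(\int_{(0,1]} t^{1/\beta}\,dY_\nu(t)\Big),\qquad \mathcal U_\beta:=\mathcal J^\beta(ID),\qquad \mathcal J:=\mathcal J^1,\quad \mathcal U:=\mathcal U_1,$$ where for $h$ absolutely continuous on $[0,1]$ one sets $\int_{(0,1]} h\,dY:=h(1)Y(1)-h(0)Y(0)-\int_0^1 Y(t)h'(t)\,dt$. The law $\mathcal J^\beta(\nu)$ exists, is again in $ID$, and depends only on $\beta$ and $\nu$. For $\nu\in ID$ let $\nu^{*1/2}$ be the unique probability measure $\eta$ with $\eta*\eta=\nu$ (it exists and is in $ID$). The elements of $\mathcal U$ are called s-selfdecomposable. Let $$\mathcal U^f:=\{\mathcal J(\rho):\ \rho\in ID,\ \mathcal J(\rho)*\rho\in\mathcal U\}.$$ Then: 1. For $\rho\in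 ID$: $\mathcal J(\rho)*\rho\in\mathcal U$ if and only if $\rho\in\mathcal U_2$. Moreover $\mathcal U^f=\mathcal J^2(\mathcal U)$. 2. For $\rho,\nu\in ID$: $\mathcal J(\rho)*\rho=\mathcal J(\nu)$ if and only if $\rho=\mathcal J^2(\nu^{*1/2})$. 3. For each $\tilde\mu\in\mathcal U$ there is a unique $\tilde\rho\in\mathcal U_2$ with $\tilde\mu=\mathcal J(\tilde\rho)*\tilde\rho$, and this $\tilde\rho$ also satisfies $\mathcal J^2(\tilde\mu)=\mathcal J(\tilde\rho^{*2})$. 4. $\mathcal U=\{\mathcal J(\rho)*\rho:\ \rho\in\mathcal U_2\}$. -/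

import Mathlib

open MeasureTheory ProbabilityTheory Filter Topology Set
open scoped NNReal

universe u

noncomputable section

/-- The `n`-fold convolution power `η^{*n}`. -/
def convPow {E : Type*} [NormedAddCommGroup E] [MeasurableSpace E] (η : Measure E) :
    ℕ → Measure E
  | 0 => Measure.dirac 0
  | n + 1 => convPow η n ∗ η

/-- The class `ID` of infinitely divisible probability measures on `E`: for every `n ≥ 1` there is
a probability measure whose `n`-fold convolution power is the given one. -/
def ID (E : Type*) [NormedAddCommGroup E] [MeasurableSpace E] : Set (Measure E) :=
  {ν | IsProbabilityMeasure ν ∧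
    ∀ n : ℕ, 1 ≤ n → ∃ η : Measure E, IsProbabilityMeasure η ∧ convPow η n = ν}

/-- The convolution square root `ν^{*1/2}`: a probability measure `η` with `η ∗ η = ν`.
For `ν` infinitely divisible it exists and is unique. -/
def convHalf {E : Type*} [NormedAddCommGroup E] [MeasurableSpace E] (ν : Measure E) :
    Measure E :=
  open Classical in
  if h : ∃ η : Measure E, IsProbabilityMeasure η ∧ η ∗ η = ν then h.choose else 0

/-- A Lévy process: stationary independent increments, starting from zero, with paths that are
right-continuous and have left limits. -/
structure IsLevyProcess {Ω E : Type*} [MeasurableSpace Ω] [NormedAddCommGroup E]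
    [MeasurableSpace E] (Y : ℝ≥0 → Ω → E) (P : Measure Ω) : Prop where
  measurable : ∀ t, Measurable (Y t)
  zero : ∀ ω, Y 0 ω = 0
  indep : HasIndepIncrements Y P
  stationary : ∀ s t, P.map (fun ω => Y (s + t) ω - Y s ω) = P.map (Y t)
  rightCts : ∀ ω t, ContinuousWithinAt (fun s => Y s ω) (Ici t) t
  leftLim : ∀ ω t, ∃ l, Tendsto (fun s => Y s ω) (𝓝[<] t) (𝓝 l)

/-- The random integral `∫_(0,1] h(t) dY(t)` of a function `h` that is absolutely continuous on
`[0,1]`, with respect to a process `Y` with càdlàg paths, defined pathwise through integration by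
parts: `h(1) Y(1) - h(0) Y(0) - ∫_(0,1] Y(t) dh(t)`, where `dh(t) = h'(t) dt`. (Since `h` is
continuous, `Y(t-)` and `Y(t)` give the same value here.) -/
def randomIntegral {Ω E : Type*} [NormedAddCommGroup E] [NormedSpace ℝ E]
    (h : ℝ → ℝ) (Y : ℝ≥0 → Ω → E) (ω : Ω) : E :=
  h 1 • Y 1 ω - h 0 • Y 0 ω - ∫ t in (0 : ℝ)..1, deriv h t • Y t.toNNReal ω

/-- `μ` is the law of `∫_(0,1] t^{1/β} dY(t)` for a Lévy process `Y` such that `Y(1)` has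
law `ν`. -/
def IsJLaw {E : Type u} [NormedAddCommGroup E] [NormedSpace ℝ E] [MeasurableSpace E]
    (β : ℝ) (ν μ : Measure E) : Prop :=
  ∃ (Ω : Type u) (_ : MeasurableSpace Ω) (P : Measure Ω) (_ : IsProbabilityMeasure P)
    (Y : ℝ≥0 → Ω → E),
    IsLevyProcess Y P ∧ P.map (Y 1) = ν ∧ P.map (randomIntegral (fun t => t ^ (1 / β)) Y) = μ

/-- The mapping `𝒥^β`, sending `ν` to the law of `∫_(0,1] t^{1/β} dY_ν(t)`. On `ID` this law exists
and does not depend on the choice of the Lévy process `Y_ν`. -/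
def J {E : Type u} [NormedAddCommGroup E] [NormedSpace ℝ E] [MeasurableSpace E]
    (β : ℝ) (ν : Measure E) : Measure E :=
  open Classical in
  if h : ∃ μ : Measure E, IsJLaw β ν μ then h.choose else 0

/-- The class `𝒰_β = 𝒥^β(ID)` of generalized s-selfdecomposable distributions; `𝒰_1` is the class
`𝒰` of s-selfdecomposable distributions. -/
def classU (E : Type u) [NormedAddCommGroup E] [NormedSpace ℝ E] [MeasurableSpace E]
    (β : ℝ) : Set (Measure E) :=
  J β '' ID E

/-- The class `𝒰_β^f` of those `μ = 𝒥^β(ρ)`, `ρ ∈ ID`, for which `𝒥^β(ρ) ∗ ρ ∈ 𝒰_β`. -/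
def classUf (E : Type u) [NormedAddCommGroup E] [NormedSpace ℝ E] [MeasurableSpace E]
    (β : ℝ) : Set (Measure E) :=
  {μ | ∃ ρ ∈ ID E, μ = J β ρ ∧ J β ρ ∗ ρ ∈ classU E β}

end

/-! Everything takes place on characteristic exponents. An infinitely divisible `ν` has a nowhere
vanishing characteristic functional, hence a unique logarithm `ψ` that is zero at `0` and continuous
on lines. Convolution adds exponents, and `𝒥^β` replaces `ψ` by `L ↦ ∫₀¹ ψ (t^(1/β) • L) dt`. Let
`A` and `B` be the linear operators so obtained for `β = 1` and `β = 2`, acting along each line `s ↦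
s • L`.

The theorem rests on two facts: `(A + 1) B = 2 A`, and `A + 1` is injective. With `θ = s d/ds` one
has formally `A = (1 + θ)⁻¹` and `B = 2 (2 + θ)⁻¹`, so `A + 1 = (2 + θ)(1 + θ)⁻¹` and the identity
is plain. The rigorous forms are `integral_integral_sqrt_add` and `eq_zero_of_integral_add_eq_zero`.
The exponent of `ν^{*1/2}` being `ψ / 2`, the equation `𝒥(ρ) ∗ ρ = 𝒥(ν)` reads `(A + 1) ψ_ρ = A ψ_ν
= (A + 1) B (ψ_ν / 2)`, whose only solution is `ρ = 𝒥²(ν^{*1/2})`. The other claims follow by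
algebra, using that `A` and `B` commute (Fubini) and that convolution squaring is a bijection of
`ID`.

Most of the work shows that `J` is not its default value, that is, that each `ν ∈ ID` has a càdlàg
Lévy process in the Banach space (`exists_levyProcess`). Random walks with the dyadic roots of `ν`
as step laws are realised consistently on all dyadic grids by an inverse limit. Compactness of
suitable centres makes the dyadic convolution powers uniformly tight, and together with the
exponents this gives continuity at time zero (`exists_norm_tail_le`). Ottaviani's inequality then
bounds the number of large oscillations geometrically, uniformly in the mesh, so almost every dyadic
path has one-sided limits and extends to a càdlàg path. -/

/-! ### Characteristic exponents and convolution roots. -/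

section Exponent

/-- Two continuous complex functions on the line with the same exponential which agree at `0` are
equal. -/
lemma eq_of_exp_eq_of_continuous {f g : ℝ → ℂ} (hf : Continuous f) (hg : Continuous g)
    (h0 : f 0 = g 0) (h : ∀ s, Complex.exp (f s) = Complex.exp (g s)) : f = g := by
  have key := Complex.isCoveringMapOn_exp.existsUnique_continuousMap_lifts
    (f := (⟨fun s => Complex.exp (g s), by fun_prop⟩ : C(ℝ, ℂ))) (a₀ := 0) (e₀ := g 0) rfl
    (fun a => by simp)
  have := key.unique (y₁ := ⟨f, hf⟩) (y₂ := ⟨g, hg⟩) ⟨h0, funext h⟩ ⟨rfl, rfl⟩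
  exact congrArg DFunLike.coe this

/-- A continuous nowhere vanishing complex function on the line has a continuous logarithm. -/
lemma exists_continuous_log {a : ℝ → ℂ} (ha : Continuous a) (h0 : a 0 = 1) (hne : ∀ s, a s ≠ 0) :
    ∃ g : ℝ → ℂ, Continuous g ∧ g 0 = 0 ∧ ∀ s, Complex.exp (g s) = a s := by
  obtain ⟨F, ⟨hF0, hF⟩, -⟩ := Complex.isCoveringMapOn_exp.existsUnique_continuousMap_lifts
    (f := (⟨a, ha⟩ : C(ℝ, ℂ))) (a₀ := 0) (e₀ := 0) (by simp [h0]) (fun s => by simpa using hne s)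
  exact ⟨F, F.continuous, hF0, fun s => congrFun hF s⟩

variable {E : Type*} [NormedAddCommGroup E] [NormedSpace ℝ E] [MeasurableSpace E]

/-- `ψ` is the characteristic exponent of `μ`: the logarithm of the characteristic functional that
vanishes at `0` and is continuous along lines. -/
structure IsExponent (μ : Measure E) (ψ : StrongDual ℝ E → ℂ) : Prop where
  cont : ∀ L, Continuous fun s : ℝ => ψ (s • L)
  zero : ψ 0 = 0
  charFunDual_eq : ∀ L, charFunDual μ L = Complex.exp (ψ L)

lemma IsExponent.unique {μ : Measure E} {ψ φ : StrongDual ℝ E → ℂ} (h : IsExponent μ ψ)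
    (h' : IsExponent μ φ) : ψ = φ := by
  ext L
  have := eq_of_exp_eq_of_continuous (h.cont L) (h'.cont L) (by simp [h.zero, h'.zero])
    (fun s => by rw [← h.charFunDual_eq, ← h'.charFunDual_eq])
  simpa using congrFun this 1

lemma IsExponent.measure_ext [CompleteSpace E] [SecondCountableTopology E] [BorelSpace E]
    {μ ν : Measure E} [IsFiniteMeasure μ] [IsFiniteMeasure ν] {ψ : StrongDual ℝ E → ℂ}
    (h : IsExponent μ ψ) (h' : IsExponent ν ψ) : μ = ν :=
  Measure.ext_of_charFunDual (by ext L; rw [h.charFunDual_eq, h'.charFunDual_eq])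

lemma IsExponent.conv [SecondCountableTopology E] [BorelSpace E] {μ ν : Measure E}
    [IsFiniteMeasure μ] [IsFiniteMeasure ν] {ψ φ : StrongDual ℝ E → ℂ} (h : IsExponent μ ψ)
    (h' : IsExponent ν φ) : IsExponent (μ ∗ ν) (fun L => ψ L + φ L) :=
  ⟨fun L => (h.cont L).add (h'.cont L), by simp [h.zero, h'.zero], fun L => by
    rw [charFunDual_conv, h.charFunDual_eq, h'.charFunDual_eq, Complex.exp_add]⟩

instance convPow.isProbabilityMeasure [SecondCountableTopology E] [BorelSpace E] (μ : Measure E)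
    [IsProbabilityMeasure μ] (n : ℕ) : IsProbabilityMeasure (convPow μ n) := by
  induction n with
  | zero => exact Measure.dirac.isProbabilityMeasure
  | succ n ih => rw [convPow]; infer_instance

lemma charFunDual_convPow [SecondCountableTopology E] [BorelSpace E] (μ : Measure E)
    [IsProbabilityMeasure μ] (n : ℕ) (L : StrongDual ℝ E) :
    charFunDual (convPow μ n) L = charFunDual μ L ^ n := by
  induction n with
  | zero => simp [convPow]
  | succ n ih => rw [convPow, charFunDual_conv, ih, pow_succ]

lemma IsExponent.convPow [SecondCountableTopology E] [BorelSpace E] {μ : Measure E}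
    [IsProbabilityMeasure μ] {ψ : StrongDual ℝ E → ℂ} (h : IsExponent μ ψ) (n : ℕ) :
    IsExponent (convPow μ n) (fun L => n * ψ L) :=
  ⟨fun L => (h.cont L).const_mul _, by simp [h.zero], fun L => by
    rw [charFunDual_convPow, h.charFunDual_eq, Complex.exp_nat_mul]⟩

lemma integrable_exp_dual [OpensMeasurableSpace E] (μ : Measure E) [IsFiniteMeasure μ]
    (L : StrongDual ℝ E) : Integrable (fun x => Complex.exp (L x * Complex.I)) μ := by
  refine Integrable.of_bound (C := 1) (Measurable.aestronglyMeasurable (by fun_prop)) ?_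
  exact ae_of_all _ fun x => (Complex.norm_exp_ofReal_mul_I _).le

/-- Almost sure convergence implies convergence of the characteristic functionals. -/
lemma tendsto_charFunDual_map [BorelSpace E] {Ω : Type*} [MeasurableSpace Ω] {P : Measure Ω}
    [IsFiniteMeasure P] {X : ℕ → Ω → E} {Z : Ω → E} (hX : ∀ n, AEMeasurable (X n) P)
    (hZ : AEMeasurable Z P) (h : ∀ᵐ ω ∂P, Tendsto (fun n => X n ω) atTop (𝓝 (Z ω)))
    (L : StrongDual ℝ E) :
    Tendsto (fun n => charFunDual (P.map (X n)) L) atTop (𝓝 (charFunDual (P.map Z) L)) := by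
  have hc : Continuous fun v : E => Complex.exp (L v * Complex.I) := by fun_prop
  simp_rw [charFunDual_apply]
  rw [integral_map hZ (Measurable.aestronglyMeasurable (by fun_prop))]
  have h2 (n : ℕ) := integral_map (hX n) (f := fun v => Complex.exp (L v * Complex.I))
    (Measurable.aestronglyMeasurable (by fun_prop))
  simp_rw [h2]
  refine tendsto_integral_of_dominated_convergence (fun _ => 1) (fun n => ?_)
    (integrable_const _) (fun n => ae_of_all _ fun ω => ?_) (h.mono fun ω hω => ?_)
  · exact (hc.measurable.comp_aemeasurable (hX n)).aestronglyMeasurable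
  · exact (Complex.norm_exp_ofReal_mul_I _).le
  · exact (hc.tendsto _).comp hω

lemma continuous_charFunDual_smul [OpensMeasurableSpace E] [SecondCountableTopology E]
    (μ : Measure E) [IsProbabilityMeasure μ]
    (L : StrongDual ℝ E) : Continuous fun s : ℝ => charFunDual μ (s • L) := by
  simp_rw [charFunDual_apply]
  refine continuous_of_dominated (bound := fun _ => 1) (fun s => ?_) (fun s => ?_) (by simp) ?_
  · exact Measurable.aestronglyMeasurable (by fun_prop)
  · exact ae_of_all _ fun x => (Complex.norm_exp_ofReal_mul_I _).le
  · refine ae_of_all _ fun x => ?_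
    simp only [smul_apply, smul_eq_mul]
    fun_prop

lemma charFunDual_zero_eq_one (μ : Measure E) [IsProbabilityMeasure μ] : charFunDual μ 0 = 1 := by
  simp [charFunDual_apply]

/-- The characteristic exponent exists as soon as the characteristic functional has no zeros. -/
lemma exists_isExponent_of_ne_zero [OpensMeasurableSpace E] [SecondCountableTopology E]
    (μ : Measure E) [IsProbabilityMeasure μ]
    (hne : ∀ L, charFunDual μ L ≠ 0) : ∃ ψ, IsExponent μ ψ := by
  have key (L : StrongDual ℝ E) := exists_continuous_log (continuous_charFunDual_smul μ L)
    (by simp [charFunDual_zero_eq_one]) (fun s => hne (s • L))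
  choose g hgc hg0 hg using key
  -- The logarithms are chosen line by line. Uniqueness of lifts makes those on `L` and on `s • L`
  -- agree, so evaluation at `1` is one function on the dual.
  have hline (L : StrongDual ℝ E) (s : ℝ) : g (s • L) 1 = g L s := by
    have := eq_of_exp_eq_of_continuous (hgc (s • L))
      ((hgc L).comp (continuous_id.mul continuous_const : Continuous fun u : ℝ => u * s))
      (by simp [hg0]) (fun u => by simp [hg, smul_smul])
    simpa using congrFun this 1
  refine ⟨fun L => g L 1, fun L => by simpa [hline] using hgc L, ?_, fun L => by simp [hg]⟩
  simpa [hg0] using hline 0 0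

/-- A convolution root of a measure with exponent `ψ` has exponent `ψ / n`. -/
lemma IsExponent.of_convPow [SecondCountableTopology E] [BorelSpace E] {μ η : Measure E}
    [IsProbabilityMeasure η] {ψ : StrongDual ℝ E → ℂ} (h : IsExponent μ ψ) {n : ℕ} (hn : n ≠ 0)
    (hη : _root_.convPow η n = μ) : IsExponent η (fun L => ψ L / n) := by
  subst hη
  obtain ⟨φ, hφ⟩ := exists_isExponent_of_ne_zero η fun L hL => by
    have := h.charFunDual_eq L
    rw [charFunDual_convPow, hL, zero_pow hn] at this
    exact Complex.exp_ne_zero _ this.symm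
  have := (hφ.convPow n).unique h
  convert hφ using 2 with L
  rw [← this]
  field_simp

/-- Integrates `1 - cos 2x = 2 (1 - cos x)(1 + cos x) ≤ 4 (1 - cos x)`. -/
lemma one_sub_re_charFunDual_two_smul_le [OpensMeasurableSpace E] [SecondCountableTopology E]
    (σ : Measure E) [IsProbabilityMeasure σ] (L : StrongDual ℝ E) :
    1 - (charFunDual σ ((2 : ℝ) • L)).re ≤ 4 * (1 - (charFunDual σ L).re) := by
  have hre (L : StrongDual ℝ E) : (charFunDual σ L).re = ∫ x, Real.cos (L x) ∂σ := by
    rw [charFunDual_apply]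
    have := integral_re (integrable_exp_dual σ L)
    simp only [RCLike.re_eq_complex_re, Complex.exp_ofReal_mul_I_re] at this
    exact this.symm
  have hcos (L : StrongDual ℝ E) : Integrable (fun x => Real.cos (L x)) σ :=
    Integrable.of_bound (C := 1) (Measurable.aestronglyMeasurable (by fun_prop))
      (ae_of_all _ fun x => by simpa using Real.abs_cos_le_one _)
  have h1 (L : StrongDual ℝ E) : 1 - (charFunDual σ L).re = ∫ x, (1 - Real.cos (L x)) ∂σ := by
    rw [integral_sub (integrable_const _) (hcos L), hre]; simp
  rw [h1, h1, ← integral_const_mul]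
  refine integral_mono ((integrable_const _).sub (hcos _))
    (((integrable_const _).sub (hcos _)).const_mul _) fun x => ?_
  simp only [smul_apply, smul_eq_mul, Real.cos_two_mul]
  nlinarith [sq_nonneg (1 - Real.cos (L x))]

/-- Symmetrisation: `‖charFunDual μ L‖ ^ 2` is the characteristic functional of `μ` convolved with
its reflection, so the real-part estimate applies to it. -/
lemma one_sub_norm_sq_charFunDual_two_smul_le [BorelSpace E] [SecondCountableTopology E]
    (μ : Measure E) [IsProbabilityMeasure μ] (L : StrongDual ℝ E) :
    1 - ‖charFunDual μ ((2 : ℝ) • L)‖ ^ 2 ≤ 4 * (1 - ‖charFunDual μ L‖ ^ 2) := by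
  have : IsProbabilityMeasure (μ.map (fun x => -x)) :=
    Measure.isProbabilityMeasure_map (by fun_prop)
  have key (L : StrongDual ℝ E) :
      (charFunDual (μ ∗ μ.map (fun x => -x)) L).re = ‖charFunDual μ L‖ ^ 2 := by
    have : charFunDual (μ.map (fun x => -x)) L = starRingEnd ℂ (charFunDual μ L) := by
      rw [charFunDual_apply, charFunDual_apply, integral_map (by fun_prop)
        (Measurable.aestronglyMeasurable (by fun_prop)), ← integral_conj]
      congr with x
      rw [← Complex.exp_conj]
      simp
    rw [charFunDual_conv, this, Complex.mul_conj, Complex.ofReal_re, Complex.normSq_eq_norm_sq]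
  simpa only [key] using one_sub_re_charFunDual_two_smul_le (μ ∗ μ.map (fun x => -x)) L

/-- The characteristic functional of an infinitely divisible law has no zeros. -/
lemma charFunDual_ne_zero_of_mem_ID [BorelSpace E] [SecondCountableTopology E] {ν : Measure E}
    (hν : ν ∈ ID E) (L : StrongDual ℝ E) : charFunDual ν L ≠ 0 := by
  have := hν.1
  have hiter (η : Measure E) (hη : IsProbabilityMeasure η) (M : StrongDual ℝ E) (k : ℕ) :
      1 - ‖charFunDual η ((2 ^ k : ℝ) • M)‖ ^ 2 ≤ 4 ^ k * (1 - ‖charFunDual η M‖ ^ 2) := by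
    induction k with
    | zero => simp
    | succ k ih =>
      have := one_sub_norm_sq_charFunDual_two_smul_le η ((2 ^ k : ℝ) • M)
      rw [smul_smul, ← pow_succ'] at this
      rw [pow_succ' (4 : ℝ)]
      linarith
  have hlim : Tendsto (fun k : ℕ => ‖charFunDual ν (((2 ^ k : ℝ)⁻¹) • L)‖) atTop (𝓝 1) := by
    have h1 := ((continuous_charFunDual_smul ν L).norm.tendsto 0)
    simp only [zero_smul, charFunDual_zero_eq_one, norm_one] at h1
    refine h1.comp ?_
    simpa using tendsto_pow_atTop_nhds_zero_of_lt_one (r := (2 : ℝ)⁻¹) (by norm_num) (by norm_num)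
  -- Near `0` the functional of `ν` exceeds `1/2`. This forces a high root `η` to satisfy `1 - ‖·‖ ^
  -- 2 < 4⁻ᵏ` at `2⁻ᵏ • L`; doubling `k` times costs a factor `4ᵏ` and leaves a bound below `1` at
  -- `L`, so `η`, hence `ν`, has no zero there.
  obtain ⟨k, hk⟩ := (hlim.eventually (lt_mem_nhds (show (1 / 2 : ℝ) < 1 by norm_num))).exists
  obtain ⟨n, hn⟩ := exists_pow_lt_of_lt_one (show (0 : ℝ) < 1 / 4 by norm_num)
    (show 1 - (4 ^ k : ℝ)⁻¹ < 1 by simp)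
  obtain ⟨η, hη, hην⟩ := hν.2 (n + 1) (by omega)
  have hpos : (0 : ℝ) < (4 ^ k : ℝ)⁻¹ := by positivity
  have hle1 : (4 ^ k : ℝ)⁻¹ ≤ 1 := inv_le_one_of_one_le₀ (one_le_pow₀ (by norm_num))
  have hx : 1 - (4 ^ k : ℝ)⁻¹ < ‖charFunDual η (((2 ^ k : ℝ)⁻¹) • L)‖ ^ 2 := by
    by_contra! hcon
    have h2 := pow_le_pow_left₀ (by positivity) hcon (n + 1)
    rw [← pow_mul, mul_comm 2, pow_mul, ← norm_pow, ← charFunDual_convPow, hην] at h2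
    have h3 : (1 - (4 ^ k : ℝ)⁻¹) ^ (n + 1) ≤ (1 - (4 ^ k : ℝ)⁻¹) ^ n :=
      pow_le_pow_of_le_one (by linarith) (by linarith) (by omega)
    nlinarith
  have h4 := hiter η hη (((2 ^ k : ℝ)⁻¹) • L) k
  rw [smul_smul, mul_inv_cancel₀ (by positivity), one_smul] at h4
  intro h0
  rw [← hην, charFunDual_convPow] at h0
  rw [pow_eq_zero_iff (by omega)] at h0
  rw [h0] at h4
  have h5 : (4 : ℝ) ^ k * (4 ^ k)⁻¹ = 1 := mul_inv_cancel₀ (by positivity)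
  have h6 : (0 : ℝ) < 4 ^ k := by positivity
  simp only [norm_zero] at h4
  nlinarith

lemma exists_isExponent_of_mem_ID [BorelSpace E] [SecondCountableTopology E] {ν : Measure E}
    (hν : ν ∈ ID E) : ∃ ψ, IsExponent ν ψ :=
  have := hν.1
  exists_isExponent_of_ne_zero ν (charFunDual_ne_zero_of_mem_ID hν)

variable [CompleteSpace E] [BorelSpace E] [SecondCountableTopology E]

/-- Convolution roots of an infinitely divisible law are unique. -/
lemma convPow_root_unique {ν η η' : Measure E} (hν : ν ∈ ID E) [IsProbabilityMeasure η]
    [IsProbabilityMeasure η'] {n : ℕ} (hn : n ≠ 0) (h : convPow η n = ν) (h' : convPow η' n = ν) :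
    η = η' := by
  obtain ⟨ψ, hψ⟩ := exists_isExponent_of_mem_ID hν
  exact (hψ.of_convPow hn h).measure_ext (hψ.of_convPow hn h')

lemma convPow_mul (μ : Measure E) [IsProbabilityMeasure μ] (m n : ℕ) :
    convPow μ (m * n) = convPow (convPow μ m) n :=
  Measure.ext_of_charFunDual (by ext L; simp [charFunDual_convPow, pow_mul])

lemma convPow_add (μ : Measure E) [IsProbabilityMeasure μ] (m n : ℕ) :
    convPow μ (m + n) = convPow μ m ∗ convPow μ n :=
  Measure.ext_of_charFunDual (by ext L; simp [charFunDual_convPow, charFunDual_conv, pow_add])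

/-- Convolution roots of an infinitely divisible law are infinitely divisible. -/
lemma mem_ID_of_convPow_eq {ν η : Measure E} (hν : ν ∈ ID E) [hη : IsProbabilityMeasure η] {n : ℕ}
    (hn : n ≠ 0) (h : convPow η n = ν) : η ∈ ID E := by
  refine ⟨hη, fun m hm => ?_⟩
  obtain ⟨ζ, hζ, hζν⟩ := hν.2 (m * n) (Nat.mul_pos hm (Nat.pos_of_ne_zero hn))
  refine ⟨ζ, hζ, convPow_root_unique hν hn ?_ h⟩
  rw [← convPow_mul, hζν]

lemma convPow_one (μ : Measure E) [IsProbabilityMeasure μ] : convPow μ 1 = μ :=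
  Measure.ext_of_charFunDual (by ext L; simp [charFunDual_convPow])

lemma convPow_two (μ : Measure E) [IsProbabilityMeasure μ] : convPow μ 2 = μ ∗ μ :=
  Measure.ext_of_charFunDual
    (by ext L; rw [charFunDual_convPow, charFunDual_conv, sq])

lemma convHalf_spec {ν : Measure E} (hν : ν ∈ ID E) :
    convHalf ν ∈ ID E ∧ convHalf ν ∗ convHalf ν = ν ∧
      ∀ η : Measure E, IsProbabilityMeasure η → η ∗ η = ν → η = convHalf ν := by
  have hex : ∃ η : Measure E, IsProbabilityMeasure η ∧ η ∗ η = ν := by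
    obtain ⟨η, hη, h⟩ := hν.2 2 (by norm_num)
    exact ⟨η, hη, by rw [← convPow_two, h]⟩
  have hdef : convHalf ν = hex.choose := by rw [convHalf, dif_pos hex]
  have hp : IsProbabilityMeasure (convHalf ν) := hdef ▸ hex.choose_spec.1
  have hc : convHalf ν ∗ convHalf ν = ν := by rw [hdef]; exact hex.choose_spec.2
  refine ⟨mem_ID_of_convPow_eq hν two_ne_zero (by rw [convPow_two, hc]), hc, fun η hη h => ?_⟩
  exact convPow_root_unique hν two_ne_zero (by rw [convPow_two, h]) (by rw [convPow_two, hc])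

end Exponent

/-! ### Riemann and Stieltjes sums of càdlàg functions. -/

section RandomIntegral

/-- A right-continuous function with left limits is bounded on compact intervals. -/
lemma exists_norm_le_of_cadlag {F : Type*} [NormedAddCommGroup F] {f : ℝ≥0 → F}
    (hr : ∀ t, ContinuousWithinAt f (Ici t) t) (hl : ∀ t, ∃ l, Tendsto f (𝓝[<] t) (𝓝 l))
    (T : ℝ≥0) : ∃ C, ∀ s ≤ T, ‖f s‖ ≤ C := by
  have key : ∃ C, ∀ s ∈ Icc 0 T, ‖f s‖ ≤ C := by
    refine isCompact_Icc.induction_on (p := fun A => ∃ C, ∀ s ∈ A, ‖f s‖ ≤ C) (by simp) ?_ ?_ ?_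
    · rintro A B hAB ⟨C, hC⟩
      exact ⟨C, fun s hs => hC s (hAB hs)⟩
    · rintro A B ⟨C, hC⟩ ⟨D, hD⟩
      refine ⟨max C D, ?_⟩
      rintro s (hs | hs)
      · exact (hC s hs).trans (le_max_left _ _)
      · exact (hD s hs).trans (le_max_right _ _)
    · intro t _
      obtain ⟨l, hlt⟩ := hl t
      have h1 : ∀ᶠ s in 𝓝[<] t, ‖f s‖ ≤ max (‖l‖ + 1) (‖f t‖ + 1) :=
        (hlt.norm.eventually (gt_mem_nhds (lt_add_one _))).mono
          fun s hs => hs.le.trans (le_max_left _ _)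
      have h2 : ∀ᶠ s in 𝓝[≥] t, ‖f s‖ ≤ max (‖l‖ + 1) (‖f t‖ + 1) :=
        ((hr t).norm.eventually (gt_mem_nhds (lt_add_one _))).mono
          fun s hs => hs.le.trans (le_max_right _ _)
      have h3 : ∀ᶠ s in 𝓝 t, ‖f s‖ ≤ max (‖l‖ + 1) (‖f t‖ + 1) := by
        rw [← nhdsLT_sup_nhdsGE]; exact eventually_sup.2 ⟨h1, h2⟩
      exact ⟨_, mem_nhdsWithin_of_mem_nhds h3, _, fun s hs => hs⟩
  obtain ⟨C, hC⟩ := key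
  exact ⟨C, fun s hs => hC s ⟨bot_le, hs⟩⟩

/-- The point of the grid of mesh `1 / N` that comes right after `t`. -/
noncomputable def gridNext (N : ℕ) (t : ℝ) : ℝ≥0 := ((⌊N * t⌋₊ + 1 : ℕ) : ℝ≥0) / N

lemma lt_gridNext {N : ℕ} (hN : 0 < N) (t : ℝ) : t < gridNext N t := by
  have h := Nat.lt_floor_add_one (N * t)
  have hN' : (0 : ℝ) < N := by exact_mod_cast hN
  simp only [gridNext, NNReal.coe_div, NNReal.coe_natCast, Nat.cast_add, Nat.cast_one]
  rw [lt_div_iff₀ hN']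
  push_cast
  linarith

lemma gridNext_le {N : ℕ} (hN : 0 < N) {t : ℝ} (ht : 0 ≤ t) :
    (gridNext N t : ℝ) ≤ t + 1 / N := by
  have hN' : (0 : ℝ) < N := by exact_mod_cast hN
  have h := Nat.floor_le (mul_nonneg hN'.le ht)
  simp only [gridNext, NNReal.coe_div, NNReal.coe_natCast, Nat.cast_add, Nat.cast_one]
  rw [div_le_iff₀ hN', add_mul, one_div, inv_mul_cancel₀ hN'.ne']
  push_cast
  linarith

lemma tendsto_gridNext {t : ℝ} (ht : 0 ≤ t) :
    Tendsto (fun N : ℕ => gridNext N t) atTop (𝓝[>] t.toNNReal) := by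
  refine tendsto_nhdsWithin_iff.2 ⟨?_, ?_⟩
  · rw [← NNReal.tendsto_coe, Real.coe_toNNReal _ ht]
    have h1 : Tendsto (fun N : ℕ => t + 1 / (N : ℝ)) atTop (𝓝 t) := by
      simpa using (tendsto_one_div_atTop_nhds_zero_nat (𝕜 := ℝ)).const_add t
    refine tendsto_of_tendsto_of_tendsto_of_le_of_le' tendsto_const_nhds h1 ?_ ?_
    · filter_upwards [eventually_gt_atTop 0] with N hN using (lt_gridNext hN t).le
    · filter_upwards [eventually_gt_atTop 0] with N hN using gridNext_le hN ht
  · filter_upwards [eventually_gt_atTop 0] with N hN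
    rw [mem_Ioi, ← NNReal.coe_lt_coe, Real.coe_toNNReal _ ht]
    exact lt_gridNext hN t

lemma gridNext_le_one {N : ℕ} (hN : 0 < N) {t : ℝ} (ht : 0 ≤ t) (ht1 : t < 1) :
    gridNext N t ≤ 1 := by
  have hN' : (0 : ℝ) < N := by exact_mod_cast hN
  have h : ⌊N * t⌋₊ < N := (Nat.floor_lt (by positivity)).2 (by nlinarith)
  rw [gridNext, div_le_one (by exact_mod_cast hN)]
  exact_mod_cast h

/-- Abel summation, the discrete form of the integration by parts that defines `randomIntegral`. -/
lemma sum_smul_sub_eq {F : Type*} [AddCommGroup F] [Module ℝ F] (c : ℕ → ℝ) (y : ℕ → F) (m : ℕ) :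
    ∑ k ∈ Finset.range m, c k • (y (k + 1) - y k) =
      c m • y m - c 0 • y 0 - ∑ k ∈ Finset.range m, (c (k + 1) - c k) • y (k + 1) := by
  induction m with
  | zero => simp
  | succ m ih =>
    rw [Finset.sum_range_succ, Finset.sum_range_succ, ih]
    module

variable {F : Type*} [NormedAddCommGroup F] [NormedSpace ℝ F] [MeasurableSpace F] [BorelSpace F]
  [SecondCountableTopology F]

/-- Stieltjes sums of a càdlàg function against an absolutely continuous one converge. -/
lemma tendsto_stieltjes_sum [CompleteSpace F] {h : ℝ → ℝ}
    (hint : IntervalIntegrable (deriv h) volume 0 1)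
    (hftc : ∀ a b : ℝ, 0 ≤ a → a ≤ b → b ≤ 1 → ∫ t in a..b, deriv h t = h b - h a)
    {f : ℝ≥0 → F} (hr : ∀ t, ContinuousWithinAt f (Ici t) t)
    (hl : ∀ t, ∃ l, Tendsto f (𝓝[<] t) (𝓝 l)) :
    Tendsto (fun N : ℕ => ∑ k ∈ Finset.range N,
      (h ((k + 1 : ℕ) / N) - h (k / N)) • f ((k + 1 : ℕ) / N)) atTop
      (𝓝 (∫ t in (0 : ℝ)..1, deriv h t • f t.toNNReal)) := by
  obtain ⟨C, hC⟩ := exists_norm_le_of_cadlag hr hl 1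
  -- The composite factors through the floor into `ℕ`, so `f` itself need not be measurable.
  have hmeas (N : ℕ) : Measurable fun t : ℝ => f (gridNext N t) := by
    have : Measurable fun t : ℝ => ⌊N * t⌋₊ := Nat.measurable_floor.comp (by fun_prop)
    exact (measurable_from_nat (f := fun k : ℕ => f (((k + 1 : ℕ) : ℝ≥0) / N))).comp this
  have hlim : Tendsto (fun N : ℕ => ∫ t in (0 : ℝ)..1, deriv h t • f (gridNext N t)) atTop
      (𝓝 (∫ t in (0 : ℝ)..1, deriv h t • f t.toNNReal)) := by
    -- The endpoint `1` is dropped because `gridNext N 1` lies beyond `1`, where the bound `C` is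
    -- not available.
    simp_rw [intervalIntegral.integral_of_le zero_le_one, integral_Ioc_eq_integral_Ioo]
    have hint' : IntegrableOn (deriv h) (Ioo 0 1) :=
      ((intervalIntegrable_iff_integrableOn_Ioc_of_le zero_le_one).1 hint).mono_set
        Ioo_subset_Ioc_self
    refine tendsto_integral_filter_of_dominated_convergence (fun t => ‖deriv h t‖ * C) ?_ ?_
      (hint'.norm.mul_const C) ?_
    · exact Eventually.of_forall fun N =>
        hint'.aestronglyMeasurable.smul (hmeas N).stronglyMeasurable.aestronglyMeasurable
    · filter_upwards [eventually_gt_atTop 0] with N hN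
      filter_upwards [ae_restrict_mem measurableSet_Ioo] with t ht
      rw [norm_smul]
      exact mul_le_mul_of_nonneg_left (hC _ (gridNext_le_one hN ht.1.le ht.2)) (norm_nonneg _)
    · filter_upwards [ae_restrict_mem measurableSet_Ioo] with t ht
      exact (((hr _).mono Ioi_subset_Ici_self).tendsto.comp (tendsto_gridNext ht.1.le)).const_smul _
  refine hlim.congr' ?_
  filter_upwards [eventually_gt_atTop 0] with N hN
  have hN' : (0 : ℝ) < N := by exact_mod_cast hN
  have hle (k : ℕ) : (k / N : ℝ) ≤ ((k + 1 : ℕ) / N : ℝ) := by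
    gcongr; omega
  have hpiece (k : ℕ) : ∀ t ∈ Ioo (k / N : ℝ) ((k + 1 : ℕ) / N : ℝ),
      deriv h t • f ((k + 1 : ℕ) / N) = deriv h t • f (gridNext N t) := by
    rintro t ⟨h1, h2⟩
    rw [div_lt_iff₀ hN'] at h1
    rw [lt_div_iff₀ hN'] at h2
    have : ⌊N * t⌋₊ = k := by
      rw [Nat.floor_eq_iff (by have : (0 : ℝ) ≤ k := by positivity
                               linarith)]
      push_cast at h2
      constructor <;> linarith
    rw [gridNext, this]
  have hsub (k : ℕ) (hk : k < N) : IntervalIntegrable (fun t => deriv h t) volume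
      (k / N) ((k + 1 : ℕ) / N) := by
    refine hint.mono_set ?_
    rw [uIcc_of_le (hle k), uIcc_of_le zero_le_one]
    refine Icc_subset_Icc (by positivity) ?_
    rw [div_le_one hN']
    exact_mod_cast hk
  have hpi (k : ℕ) (hk : k < N) : IntervalIntegrable (fun t => deriv h t • f (gridNext N t)) volume
      (k / N) ((k + 1 : ℕ) / N) := by
    have hc : IntervalIntegrable (fun t => deriv h t • f ((k + 1 : ℕ) / N)) volume
        (k / N) ((k + 1 : ℕ) / N) :=
      ⟨(hsub k hk).1.smul_const _, (hsub k hk).2.smul_const _⟩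
    refine hc.congr_uIoo ?_
    rw [uIoo_of_le (hle k)]
    exact hpiece k
  have hsum := intervalIntegral.sum_integral_adjacent_intervals
    (a := fun k : ℕ => (k / N : ℝ)) hpi
  simp only [Nat.cast_zero, zero_div, div_self hN'.ne'] at hsum
  rw [← hsum]
  refine Finset.sum_congr rfl fun k hk => ?_
  have hk' := Finset.mem_range.1 hk
  rw [← hftc (k / N) ((k + 1 : ℕ) / N) (by positivity) (hle k)
    (by rw [div_le_one hN']; exact_mod_cast hk'), ← intervalIntegral.integral_smul_const]
  rw [intervalIntegral.integral_of_le (hle k), intervalIntegral.integral_of_le (hle k),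
    integral_Ioc_eq_integral_Ioo, integral_Ioc_eq_integral_Ioo]
  exact (setIntegral_congr_fun measurableSet_Ioo (hpiece k)).symm

/-- The random integral is the pointwise limit of its left Riemann sums. -/
lemma tendsto_riemannSum_randomIntegral [CompleteSpace F] {Ω : Type*} {h : ℝ → ℝ}
    (hint : IntervalIntegrable (deriv h) volume 0 1)
    (hftc : ∀ a b : ℝ, 0 ≤ a → a ≤ b → b ≤ 1 → ∫ t in a..b, deriv h t = h b - h a)
    {Y : ℝ≥0 → Ω → F} {ω : Ω} (hr : ∀ t, ContinuousWithinAt (fun s => Y s ω) (Ici t) t)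
    (hl : ∀ t, ∃ l, Tendsto (fun s => Y s ω) (𝓝[<] t) (𝓝 l)) :
    Tendsto (fun N : ℕ => ∑ k ∈ Finset.range N,
      h (k / N) • (Y ((k + 1 : ℕ) / N) ω - Y (k / N) ω)) atTop (𝓝 (randomIntegral h Y ω)) := by
  have := (tendsto_stieltjes_sum hint hftc hr hl).const_sub (h 1 • Y 1 ω - h 0 • Y 0 ω)
  refine this.congr' ?_
  filter_upwards [eventually_gt_atTop 0] with N hN
  have hN' : (N : ℝ) ≠ 0 := by positivity
  have hN'' : (N : ℝ≥0) ≠ 0 := by positivity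
  rw [sum_smul_sub_eq (fun k : ℕ => h (k / N)) (fun k : ℕ => Y (k / N) ω)]
  simp [div_self hN', div_self hN'']

/-- The Stieltjes sums for the identity integrator use right endpoints; passing to left endpoints
changes them by `(g 0 - g 1) / N`, which vanishes in the limit. -/
lemma tendsto_riemann_sum [CompleteSpace F] {g : ℝ → F} (hg : Continuous g) :
    Tendsto (fun N : ℕ => ∑ k ∈ Finset.range N, (1 / N : ℝ) • g (k / N)) atTop
      (𝓝 (∫ t in (0 : ℝ)..1, g t)) := by
  have hf : Continuous fun s : ℝ≥0 => g s := by fun_prop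
  have h1 := tendsto_stieltjes_sum (h := fun t => t) (f := fun s : ℝ≥0 => g s) (by simp)
    (by intro a b _ _ _; simp) (fun t => hf.continuousWithinAt)
    (fun t => ⟨g t, (hf.tendsto t).mono_left nhdsWithin_le_nhds⟩)
  have h2 : Tendsto (fun N : ℕ => (1 / N : ℝ) • (g 0 - g 1)) atTop (𝓝 0) := by
    simpa using (tendsto_one_div_atTop_nhds_zero_nat (𝕜 := ℝ)).smul_const (g 0 - g 1)
  have h3 := h1.add h2
  have h4 : (∫ t in (0 : ℝ)..1, deriv (fun t : ℝ => t) t • g (t.toNNReal)) =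
      ∫ t in (0 : ℝ)..1, g t := by
    refine intervalIntegral.integral_congr fun t ht => ?_
    rw [uIcc_of_le zero_le_one] at ht
    simp [ht.1]
  rw [h4, add_zero] at h3
  refine h3.congr' ?_
  filter_upwards [eventually_gt_atTop 0] with N hN
  have hN' : (N : ℝ) ≠ 0 := by positivity
  have h5 := Finset.sum_range_succ (fun k : ℕ => (1 / N : ℝ) • g (k / N)) N
  rw [Finset.sum_range_succ'] at h5
  simp only [Nat.cast_zero, zero_div, div_self hN'] at h5
  rw [smul_sub, ← sub_eq_zero]
  rw [← sub_eq_zero] at h5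
  rw [← h5]
  have h6 (k : ℕ) : (((k + 1 : ℕ) / N : ℝ) - k / N) • g (((k + 1 : ℕ) / N : ℝ≥0) : ℝ) =
      (1 / N : ℝ) • g ((k + 1 : ℕ) / N) := by
    rw [← sub_div]
    push_cast
    ring_nf
  rw [Finset.sum_congr rfl fun k _ => h6 k]
  abel

end RandomIntegral

/-! ### The exponent of a random integral. -/

section LevyLaw

variable {Ω E : Type*} [MeasurableSpace Ω] [NormedAddCommGroup E] [NormedSpace ℝ E]
  [SecondCountableTopology E] [MeasurableSpace E] [BorelSpace E]
  {Y : ℝ≥0 → Ω → E} {P : Measure Ω}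

/-- Independence of the increments gives the product; stationarity gives every factor the law of `Y
(1 / N)`. -/
lemma IsLevyProcess.charFunDual_sum (hY : IsLevyProcess Y P) {N : ℕ} (c : ℕ → ℝ)
    (L : StrongDual ℝ E) :
    charFunDual (P.map fun ω => ∑ k ∈ Finset.range N, c k • (Y ((k + 1 : ℕ) / N) ω - Y (k / N) ω))
      L = ∏ k ∈ Finset.range N, charFunDual (P.map (Y (1 / N))) (c k • L) := by
  have hm (k : ℕ) : Measurable (fun ω => Y ((k + 1 : ℕ) / N) ω - Y (k / N) ω) :=
    (hY.measurable _).sub (hY.measurable _)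
  have hind := hY.indep.nat (t := fun k : ℕ => (k / N : ℝ≥0)) (fun a b hab => by
    simp only; gcongr)
  have hind' : iIndepFun (fun (k : ℕ) ω => c k • (Y ((k + 1 : ℕ) / N) ω - Y (k / N) ω)) P :=
    hind.comp (fun k x => c k • x) (fun k => by fun_prop)
  rw [iIndepFun.charFunDual_map_fun_finsetSum_eq_prod
    (X := fun (k : ℕ) ω => c k • (Y ((k + 1 : ℕ) / N) ω - Y (k / N) ω))
    (fun k _ => ((hm k).const_smul (c k)).aemeasurable) (hind'.restrict _), Finset.prod_apply]
  refine Finset.prod_congr rfl fun k _ => ?_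
  have hmc : Measurable fun ω => c k • (Y ((k + 1 : ℕ) / N) ω - Y (k / N) ω) :=
    (hm k).const_smul (c k)
  have h1 : P.map (fun ω => Y ((k + 1 : ℕ) / N) ω - Y (k / N) ω) = P.map (Y (1 / N)) := by
    rw [← hY.stationary (k / N) (1 / N)]
    push_cast
    rw [add_div]
  rw [← h1, charFunDual_apply, charFunDual_apply,
    integral_map hmc.aemeasurable
    (Measurable.aestronglyMeasurable (by fun_prop)), integral_map (hm k).aemeasurable
    (Measurable.aestronglyMeasurable (by fun_prop))]
  simp

variable [CompleteSpace E] [IsProbabilityMeasure P]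

/-- With unit weights the sum of increments telescopes, so the law of `Y (1 / N)` is an `N`-th
convolution root of that of `Y 1`. -/
lemma IsLevyProcess.isExponent_inv (hY : IsLevyProcess Y P) {ψ : StrongDual ℝ E → ℂ}
    (hψ : IsExponent (P.map (Y 1)) ψ) {N : ℕ} (hN : N ≠ 0) :
    IsExponent (P.map (Y (1 / N))) (fun L => ψ L / N) := by
  have hp (t : ℝ≥0) : IsProbabilityMeasure (P.map (Y t)) :=
    Measure.isProbabilityMeasure_map (hY.measurable t).aemeasurable
  refine hψ.of_convPow hN (Measure.ext_of_charFunDual ?_)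
  ext L
  have := hY.charFunDual_sum (N := N) (fun _ => 1) L
  simp only [one_smul, Finset.prod_const, Finset.card_range] at this
  rw [charFunDual_convPow, ← this]
  congr 2
  ext ω
  rw [Finset.sum_range_sub (fun k : ℕ => Y (k / N) ω)]
  simp [hY.zero, div_self (show (N : ℝ≥0) ≠ 0 by exact_mod_cast hN)]

/-- The random integral is measurable, and its exponent is `∫₀¹ ψ (h t • L) dt`. -/
lemma IsLevyProcess.isExponent_randomIntegral (hY : IsLevyProcess Y P) {ψ : StrongDual ℝ E → ℂ}
    (hψ : IsExponent (P.map (Y 1)) ψ) {h : ℝ → ℝ} (hc : Continuous h)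
    (hint : IntervalIntegrable (deriv h) volume 0 1)
    (hftc : ∀ a b : ℝ, 0 ≤ a → a ≤ b → b ≤ 1 → ∫ t in a..b, deriv h t = h b - h a) :
    Measurable (randomIntegral h Y) ∧
      IsExponent (P.map (randomIntegral h Y)) (fun L => ∫ t in (0 : ℝ)..1, ψ (h t • L)) := by
  have hlim (ω : Ω) := tendsto_riemannSum_randomIntegral hint hftc
    (hY.rightCts ω) (hY.leftLim ω)
  have hmN (N : ℕ) : Measurable fun ω => ∑ k ∈ Finset.range N,
      h (k / N) • (Y ((k + 1 : ℕ) / N) ω - Y (k / N) ω) :=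
    Finset.measurable_fun_sum _ fun k _ =>
      ((hY.measurable _).sub (hY.measurable _)).const_smul _
  have hm : Measurable (randomIntegral h Y) :=
    measurable_of_tendsto_metrizable hmN (tendsto_pi_nhds.2 hlim)
  refine ⟨hm, fun L => ?_, by simp [hψ.zero], fun L => ?_⟩
  · have h1 : Continuous (Function.uncurry fun (s t : ℝ) => ψ (h t • s • L)) := by
      have : (Function.uncurry fun (s t : ℝ) => ψ (h t • s • L)) =
          (fun r : ℝ => ψ (r • L)) ∘ fun p : ℝ × ℝ => h p.2 * p.1 := by
        ext p; simp [Function.uncurry, smul_smul]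
      rw [this]
      exact (hψ.cont L).comp (by fun_prop)
    exact intervalIntegral.continuous_parametric_intervalIntegral_of_continuous' h1 0 1
  -- The pathwise Riemann sums converge in law, and their exponents are Riemann sums of `∫₀¹ ψ (h t
  -- • L) dt`; the two limits must agree.
  · have h1 : Tendsto (fun N : ℕ => charFunDual (P.map fun ω => ∑ k ∈ Finset.range N,
        h (k / N) • (Y ((k + 1 : ℕ) / N) ω - Y (k / N) ω)) L) atTop
        (𝓝 (charFunDual (P.map (randomIntegral h Y)) L)) :=
      tendsto_charFunDual_map (fun N => (hmN N).aemeasurable) hm.aemeasurable (ae_of_all _ hlim) L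
    have h2 : Tendsto (fun N : ℕ => Complex.exp (∑ k ∈ Finset.range N,
        (1 / N : ℝ) • ψ (h (k / N) • L))) atTop
        (𝓝 (Complex.exp (∫ t in (0 : ℝ)..1, ψ (h t • L)))) :=
      (Complex.continuous_exp.tendsto _).comp
        (tendsto_riemann_sum (g := fun t => ψ (h t • L)) ((hψ.cont L).comp hc))
    refine tendsto_nhds_unique h1 (h2.congr' ?_)
    filter_upwards [eventually_gt_atTop 0] with N hN
    rw [hY.charFunDual_sum (fun k => h (k / N)) L, Complex.exp_sum]
    refine Finset.prod_congr rfl fun k _ => ?_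
    rw [(hY.isExponent_inv hψ hN.ne').charFunDual_eq]
    congr 1
    rw [Complex.real_smul]
    push_cast
    ring

end LevyLaw

/-! ### The two operator facts: injectivity and the factorization identity. -/

section ExponentCalculus

lemma continuous_integral_comp_mul {φ h : ℝ → ℂ} {k : ℝ → ℝ} (hφ : Continuous φ)
    (hk : Continuous k) (hh : ∀ s, h s = ∫ t in (0 : ℝ)..1, φ (k t * s)) : Continuous h := by
  have : Continuous (Function.uncurry fun (s t : ℝ) => φ (k t * s)) := by
    unfold Function.uncurry; fun_prop
  rw [funext hh]
  exact intervalIntegral.continuous_parametric_intervalIntegral_of_continuous' this 0 1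

/-- Averaging over scalings is injective after adding the identity. -/
lemma eq_zero_of_integral_add_eq_zero {d : ℝ → ℂ} (hd : Continuous d)
    (h : ∀ s, (∫ t in (0 : ℝ)..1, d (t * s)) + d s = 0) : d 1 = 0 := by
  -- Since `F s` is `s` times the average of `d`, the hypothesis becomes `F + s F' = 0`, i.e. `(s
  -- F)' = 0`. Hence `s F` is constantly `0`, and at `s = 1` both `F` and `F'` vanish.
  set F : ℝ → ℂ := fun s => ∫ v in (0 : ℝ)..s, d v with hF
  have hder (s : ℝ) : HasDerivAt F (d s) s := hd.integral_hasStrictDerivAt 0 s |>.hasDerivAt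
  have hFs (s : ℝ) : F s + s * d s = 0 := by
    have h1 := intervalIntegral.smul_integral_comp_mul_right (f := d) (a := 0) (b := 1) s
    simp only [zero_mul, one_mul, Complex.real_smul] at h1
    have := h s
    calc F s + s * d s = s * ((∫ t in (0 : ℝ)..1, d (t * s)) + d s) := by
          rw [mul_add, h1]
      _ = 0 := by rw [this, mul_zero]
  have hconst (s : ℝ) : HasDerivAt (fun s : ℝ => (s : ℂ) * F s) 0 s := by
    have h1 : HasDerivAt (fun s : ℝ => (s : ℂ)) 1 s := Complex.ofRealCLM.hasDerivAt
    have := h1.mul (hder s)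
    rwa [one_mul, hFs] at this
  have hz (s : ℝ) : (s : ℂ) * F s = 0 := by
    have := is_const_of_deriv_eq_zero (fun s => (hconst s).differentiableAt)
      (fun s => (hconst s).deriv) s 0
    simpa using this
  have h1 : F 1 = 0 := by simpa using hz 1
  have := hFs 1
  simpa [h1] using this

/-- Put `G u = ∫₀¹ φ (√t u) dt`. The substitution gives `u² G u = ∫₀ᵘ 2 v φ v dv`, hence `(u G)' = 2
φ - G` for `u > 0`. Integration over `[0, 1]` yields `G 1 + ∫ G = 2 ∫ φ`. -/
lemma integral_integral_sqrt_add {φ : ℝ → ℂ} (hφ : Continuous φ) :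
    (∫ u in (0 : ℝ)..1, ∫ t in (0 : ℝ)..1, φ (t ^ (1 / 2 : ℝ) * u)) +
      ∫ t in (0 : ℝ)..1, φ (t ^ (1 / 2 : ℝ)) = 2 * ∫ u in (0 : ℝ)..1, φ u := by
  set G : ℝ → ℂ := fun u => ∫ t in (0 : ℝ)..1, φ (t ^ (1 / 2 : ℝ) * u) with hG
  have hsq : Continuous fun t : ℝ => t ^ (1 / 2 : ℝ) := Real.continuous_rpow_const (by norm_num)
  have hGc : Continuous G := continuous_integral_comp_mul hφ hsq fun s => rfl
  -- substitution `t = v ^ 2`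
  have hsub (u : ℝ) (hu : 0 < u) :
      (u : ℂ) ^ 2 * G u = ∫ v in (0 : ℝ)..u, (2 * v : ℂ) * φ v := by
    have h1 : ∫ v in (0 : ℝ)..1, (2 * v : ℝ) • ((fun t : ℝ => φ (t ^ (1 / 2 : ℝ) * u)) ∘
        fun v : ℝ => v ^ 2) v = ∫ t in ((0 : ℝ) ^ 2)..(1 : ℝ) ^ 2, φ (t ^ (1 / 2 : ℝ) * u) :=
      intervalIntegral.integral_deriv_smul_comp (fun v _ => by simpa using hasDerivAt_pow 2 v)
        (by fun_prop) (by fun_prop)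
    have h2 : ∫ v in (0 : ℝ)..1, (2 * v : ℝ) • ((fun t : ℝ => φ (t ^ (1 / 2 : ℝ) * u)) ∘
        fun v : ℝ => v ^ 2) v = ∫ v in (0 : ℝ)..1, (2 * v : ℂ) * φ (v * u) := by
      refine intervalIntegral.integral_congr fun v hv => ?_
      rw [uIcc_of_le zero_le_one] at hv
      have : (v ^ 2) ^ (1 / 2 : ℝ) = v := by
        rw [← Real.sqrt_eq_rpow, Real.sqrt_sq hv.1]
      simp only [Function.comp, this, Complex.real_smul]
      push_cast
      rfl
    have h3 := intervalIntegral.smul_integral_comp_mul_right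
      (f := fun v : ℝ => (2 * v : ℂ) * φ v) (a := 0) (b := 1) u
    simp only [zero_mul, one_mul, Complex.real_smul] at h3
    have hGu : G u = ∫ t in (0 : ℝ)..1, φ (t ^ (1 / 2 : ℝ) * u) := rfl
    rw [← h3, hGu]
    simp only [zero_pow two_ne_zero, one_pow] at h1
    rw [← h1, h2, sq, mul_assoc, ← intervalIntegral.integral_const_mul (u : ℂ)]
    congr 1
    refine intervalIntegral.integral_congr fun v _ => ?_
    push_cast
    ring
  have hder (u : ℝ) (hu : 0 < u) : HasDerivAt (fun u : ℝ => (u : ℂ) * G u) (2 * φ u - G u) u := by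
    have hH : HasDerivAt (fun u : ℝ => ∫ v in (0 : ℝ)..u, (2 * v : ℂ) * φ v) ((2 * u) * φ u) u :=
      (Continuous.integral_hasStrictDerivAt (by fun_prop) 0 u).hasDerivAt
    have hid : HasDerivAt (fun s : ℝ => (s : ℂ)) 1 u := Complex.ofRealCLM.hasDerivAt
    have hu' : (u : ℂ) ≠ 0 := by exact_mod_cast hu.ne'
    have hdiv := hH.div hid hu'
    have heq : (fun u : ℝ => (u : ℂ) * G u) =ᶠ[𝓝 u]
        fun u : ℝ => (∫ v in (0 : ℝ)..u, (2 * v : ℂ) * φ v) / u := by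
      filter_upwards [lt_mem_nhds hu] with s hs
      have hs' : (s : ℂ) ≠ 0 := by exact_mod_cast hs.ne'
      rw [← hsub s hs]
      field_simp
    refine (hdiv.congr_of_eventuallyEq heq).congr_deriv ?_
    rw [← hsub u hu]
    field_simp
  have hint := intervalIntegral.integral_eq_sub_of_hasDerivAt_of_le (a := 0) (b := 1)
    (f := fun u : ℝ => (u : ℂ) * G u) (f' := fun u => 2 * φ u - G u) zero_le_one
    (by fun_prop) (fun u hu => hder u hu.1) (Continuous.intervalIntegrable (by fun_prop) _ _)
  rw [intervalIntegral.integral_sub (Continuous.intervalIntegrable (by fun_prop) _ _)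
    (hGc.intervalIntegrable _ _), intervalIntegral.integral_const_mul] at hint
  have hG1 : G 1 = ∫ t in (0 : ℝ)..1, φ (t ^ (1 / 2 : ℝ)) := by simp [hG]
  rw [← hG1]
  simp only [Complex.ofReal_one, one_mul, Complex.ofReal_zero, zero_mul, sub_zero] at hint
  rw [← hint]
  ring

end ExponentCalculus

/-! ### Power integrands and the law `J β ν`. -/

section JLaw

variable {E : Type u} [NormedAddCommGroup E] [NormedSpace ℝ E] [CompleteSpace E]
  [SecondCountableTopology E] [MeasurableSpace E] [BorelSpace E]

/-- The derivative may blow up at `0` (when `β > 1`), but its exponent `1 / β - 1` exceeds `-1`, so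
it is integrable there. -/
lemma rpow_integral_deriv {β : ℝ} (hβ : 0 < β) :
    IntervalIntegrable (deriv fun t : ℝ => t ^ (1 / β)) volume 0 1 ∧
      ∀ a b : ℝ, 0 ≤ a → a ≤ b → b ≤ 1 →
        ∫ t in a..b, deriv (fun t : ℝ => t ^ (1 / β)) t = b ^ (1 / β) - a ^ (1 / β) := by
  have hβ' : 0 < 1 / β := by positivity
  have hd (a b : ℝ) (ha : 0 ≤ a) (hab : a ≤ b) :
      EqOn (fun t : ℝ => (1 / β) * t ^ (1 / β - 1)) (deriv fun t : ℝ => t ^ (1 / β))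
        (uIoo a b) := by
    intro t ht
    rw [uIoo_of_le hab] at ht
    exact (Real.deriv_rpow_const t (1 / β)).symm
  refine ⟨((intervalIntegral.intervalIntegrable_rpow' (by linarith)).const_mul _).congr_uIoo
    (hd 0 1 le_rfl zero_le_one), fun a b ha hab _ => ?_⟩
  rw [← intervalIntegral.integral_congr_uIoo (hd a b ha hab),
    intervalIntegral.integral_const_mul, integral_rpow (Or.inl (by linarith))]
  rw [sub_add_cancel]
  field_simp

lemma IsLevyProcess.isExponent_randomIntegral_rpow {Ω : Type*} [MeasurableSpace Ω]
    {Y : ℝ≥0 → Ω → E} {P : Measure Ω} [IsProbabilityMeasure P] (hY : IsLevyProcess Y P)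
    {ψ : StrongDual ℝ E → ℂ} (hψ : IsExponent (P.map (Y 1)) ψ) {β : ℝ} (hβ : 0 < β) :
    Measurable (randomIntegral (fun t => t ^ (1 / β)) Y) ∧
      IsExponent (P.map (randomIntegral (fun t => t ^ (1 / β)) Y))
        (fun L => ∫ t in (0 : ℝ)..1, ψ (t ^ (1 / β) • L)) :=
  hY.isExponent_randomIntegral hψ (Real.continuous_rpow_const (by positivity))
    (rpow_integral_deriv hβ).1 (rpow_integral_deriv hβ).2

end JLaw

section Factorization

/-- `J β ν` is the law of the random integral driven by any Lévy process with law `ν` at time `1`,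
given that such processes exist. -/
lemma J_spec_of_exists {E : Type u} [NormedAddCommGroup E] [NormedSpace ℝ E] [CompleteSpace E]
    [SecondCountableTopology E] [MeasurableSpace E] [BorelSpace E] {ν : Measure E}
    {ψ : StrongDual ℝ E → ℂ} (hψ : IsExponent ν ψ)
    (hex : ∃ (Ω : Type u) (_ : MeasurableSpace Ω) (P : Measure Ω) (_ : IsProbabilityMeasure P)
      (Y : ℝ≥0 → Ω → E), IsLevyProcess Y P ∧ P.map (Y 1) = ν) {β : ℝ} (hβ : 0 < β) :
    IsProbabilityMeasure (J β ν) ∧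
      IsExponent (J β ν) (fun L => ∫ t in (0 : ℝ)..1, ψ (t ^ (1 / β) • L)) := by
  have h : ∃ μ : Measure E, IsJLaw β ν μ := by
    obtain ⟨Ω, mΩ, P, hP, Y, hY, hν⟩ := hex
    exact ⟨_, Ω, mΩ, P, hP, Y, hY, hν, rfl⟩
  have hJ : J β ν = h.choose := by rw [J, dif_pos h]
  -- Whichever law is chosen, it comes with a driving Lévy process of its own, and the exponent
  -- formula depends on that process only through `ψ`.
  obtain ⟨Ω, mΩ, P, hP, Y, hY, hν, hμ⟩ := hJ ▸ h.choose_spec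
  obtain ⟨hm, he⟩ := hY.isExponent_randomIntegral_rpow (hν ▸ hψ) hβ
  exact ⟨hμ ▸ Measure.isProbabilityMeasure_map hm.aemeasurable, hμ ▸ he⟩

end Factorization

/-! ### Uniform tightness of the dyadic powers and continuity at time zero. -/

section Concentration

open scoped Pointwise ENNReal

variable {E : Type*} [NormedAddCommGroup E] [SecondCountableTopology E] [MeasurableSpace E]
  [BorelSpace E]

/-- The convolution factors of a law can be centred so as to be uniformly tight. -/
lemma exists_center {ν : Measure E} {C : ℕ → Set E} (hC : ∀ j, IsClosed (C j))
    (hν : ∀ j, ν (C j)ᶜ ≤ (1 / 4 : ℝ≥0∞) ^ (j + 2)) {μ μ' : Measure E} [IsProbabilityMeasure μ]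
    [IsProbabilityMeasure μ'] (h : μ ∗ μ' = ν) :
    ∃ c : E, ∀ j, μ {x | x + c ∉ C j} ≤ (1 / 2 : ℝ≥0∞) ^ (j + 2) := by
  set g : ℕ → E → ℝ≥0∞ := fun j y => μ {x | x + y ∉ C j} with hg
  have hmS (j : ℕ) : MeasurableSet {p : E × E | p.2 + p.1 ∉ C j} :=
    (measurable_snd.add measurable_fst) (hC j).measurableSet.compl
  have hgm (j : ℕ) : Measurable (g j) := measurable_measure_prodMk_left (hmS j)
  have hint (j : ℕ) : ∫⁻ y, g j y ∂μ' = ν (C j)ᶜ := by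
    have hm : Measurable fun p : E × E => p.1 + p.2 := by fun_prop
    rw [← h, Measure.conv_comm, Measure.conv,
      Measure.map_apply hm (hC j).measurableSet.compl, Measure.prod_apply
        (hm (hC j).measurableSet.compl)]
    simp only [hg, preimage, mem_compl_iff, mem_ofPred_eq, add_comm]
  -- The `μ'`-average of `g j` is at most `4 ^ -(j + 2)`, so Markov's inequality at level `2 ^ -(j +
  -- 2)` excludes centres of mass at most `2 ^ -(j + 2)`. These sum to `1 / 2`, which leaves a
  -- centre that serves every `j` at once.
  have hmarkov (j : ℕ) : μ' {y | (1 / 2 : ℝ≥0∞) ^ (j + 2) ≤ g j y} ≤ (1 / 2 : ℝ≥0∞) ^ (j + 2) := by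
    refine (meas_ge_le_lintegral_div (hgm j).aemeasurable (by simp)
      (by simp)).trans ?_
    rw [hint j]
    refine ENNReal.div_le_of_le_mul ((hν j).trans ?_)
    rw [← mul_pow]
    refine pow_le_pow_left₀ (by simp) ?_ _
    rw [one_div, one_div, ← ENNReal.mul_inv (by simp) (by simp)]
    norm_num
  have hsum : μ' (⋃ j, {y | (1 / 2 : ℝ≥0∞) ^ (j + 2) ≤ g j y}) < 1 := by
    calc _ ≤ ∑' j, (1 / 2 : ℝ≥0∞) ^ (j + 2) :=
          (measure_iUnion_le _).trans (ENNReal.tsum_le_tsum hmarkov)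
      _ = 1 / 2 := by
          simp_rw [pow_add, ENNReal.tsum_mul_right, ENNReal.tsum_geometric]
          rw [one_div, ENNReal.one_sub_inv_two, inv_inv, sq, ← mul_assoc,
            ENNReal.mul_inv_cancel (by simp) (by simp), one_mul]
      _ < 1 := by simp
  have hne : (⋃ j, {y | (1 / 2 : ℝ≥0∞) ^ (j + 2) ≤ g j y}) ≠ univ := fun hu => by
    rw [hu, measure_univ] at hsum; exact lt_irrefl _ hsum
  obtain ⟨c, hc⟩ := (ne_univ_iff_exists_notMem _).1 hne
  simp only [mem_iUnion, mem_ofPred_eq, not_exists, not_le] at hc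
  exact ⟨c, fun j => (hc j).le⟩

/-- Centres that are adapted to the same compact set are additive up to a compact error. -/
lemma center_add_sub_mem {C : Set E} {μ₁ μ₂ : Measure E} [IsProbabilityMeasure μ₁]
    [IsProbabilityMeasure μ₂] {c₁ c₂ c : E} (h1 : μ₁ {x | x + c₁ ∉ C} ≤ (1 / 4 : ℝ≥0∞))
    (h2 : μ₂ {x | x + c₂ ∉ C} ≤ (1 / 4 : ℝ≥0∞)) (hC : IsClosed C)
    (h12 : (μ₁ ∗ μ₂) {x | x + c ∉ C} ≤ (1 / 4 : ℝ≥0∞)) : c₁ + c₂ - c ∈ C + C - C := by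
  have hm (c : E) : MeasurableSet {x | x + c ∉ C} := (measurable_add_const c) hC.measurableSet.compl
  set A : Set (E × E) := Prod.fst ⁻¹' {x | x + c₁ ∉ C}
  set B : Set (E × E) := Prod.snd ⁻¹' {x | x + c₂ ∉ C}
  set D : Set (E × E) := (fun p => p.1 + p.2) ⁻¹' {x | x + c ∉ C}
  have hA : (μ₁.prod μ₂) A ≤ 1 / 4 := by
    rwa [← Measure.map_apply measurable_fst (hm _), measurePreserving_fst.map_eq]
  have hB : (μ₁.prod μ₂) B ≤ 1 / 4 := by
    rwa [← Measure.map_apply measurable_snd (hm _), measurePreserving_snd.map_eq]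
  have hD : (μ₁.prod μ₂) D ≤ 1 / 4 := by
    rwa [Measure.conv, Measure.map_apply (by fun_prop) (hm _)] at h12
  -- Three exceptional events of mass `1/4` leave a pair `(x, y)` outside all of them, and `c₁ + c₂
  -- - c = (x + c₁) + (y + c₂) - (x + y + c)`.
  have hlt : (μ₁.prod μ₂) (A ∪ B ∪ D) < 1 := by
    calc _ ≤ 1 / 4 + 1 / 4 + 1 / 4 := (measure_union_le _ _).trans
          (add_le_add ((measure_union_le _ _).trans (add_le_add hA hB)) hD)
      _ < (1 : ℝ≥0∞) := by
          have : (1 / 4 : ℝ≥0∞) = ENNReal.ofReal (1 / 4) := by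
            rw [ENNReal.ofReal_div_of_pos (by norm_num)]; simp
          rw [this, ← ENNReal.ofReal_add (by norm_num) (by norm_num),
            ← ENNReal.ofReal_add (by norm_num) (by norm_num), ENNReal.ofReal_lt_one]
          norm_num
  have hne : A ∪ B ∪ D ≠ univ := fun hu => by
    rw [hu, measure_univ] at hlt; exact lt_irrefl _ hlt
  obtain ⟨⟨x, y⟩, hxy⟩ := (ne_univ_iff_exists_notMem _).1 hne
  simp only [A, B, D, mem_union, mem_preimage, mem_ofPred_eq, not_or, not_not] at hxy
  obtain ⟨⟨hx, hy⟩, hs⟩ := hxy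
  refine ⟨_, add_mem_add hx hy, _, hs, ?_⟩
  simp only
  abel

variable [NormedSpace ℝ E]

/-- The power has exponent `(k / 2ⁿ) ψ`, and `ψ` is bounded on a compact segment of the line through
`L`. For small `k / 2ⁿ` the characteristic functional is therefore uniformly near `1` there, which
controls the tail of `L`. -/
lemma exists_dual_tail_le {ν : Measure E} {ψ : StrongDual ℝ E → ℂ} (hψ : IsExponent ν ψ)
    {η : ℕ → Measure E} [hη : ∀ n, IsProbabilityMeasure (η n)]
    (hexp : ∀ n, IsExponent (η n) (fun L => ψ L / 2 ^ n)) (L : StrongDual ℝ E) {r α : ℝ}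
    (hr : 0 < r) (hα : 0 < α) :
    ∃ δ : ℝ, 0 < δ ∧ ∀ n k : ℕ, k ≤ δ * 2 ^ n →
      (convPow (η n) k).real {x | r < |L x|} ≤ α := by
  obtain ⟨M, hM⟩ := (isCompact_Icc (a := -2 * r⁻¹) (b := 2 * r⁻¹)).exists_bound_of_continuousOn
    (hψ.cont L).continuousOn
  have hM0 : 0 ≤ M := (norm_nonneg _).trans (hM 0 ⟨by simp [hr.le], by positivity⟩)
  -- With `q = k / 2ⁿ`, the first entry gives `q M ≤ 1`, so that `‖exp z - 1‖ ≤ 2 ‖z‖` applies; the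
  -- second absorbs the final bound `(r / 2) * (2 q M) * (4 / r) = 4 q M`.
  refine ⟨min (1 / (M + 1)) (α / (4 * (M + 1))), by positivity, fun n k hk => ?_⟩
  set q : ℝ := k / 2 ^ n with hq
  have hqk : q ≤ min (1 / (M + 1)) (α / (4 * (M + 1))) := by
    rwa [hq, div_le_iff₀ (by positivity)]
  have hq0 : 0 ≤ q := by positivity
  have hq1 : q * (M + 1) ≤ 1 := by
    rw [← le_div_iff₀ (by positivity)]; exact hqk.trans (min_le_left _ _)
  have hq2 : q * (4 * (M + 1)) ≤ α := by
    rw [← le_div_iff₀ (by positivity)]; exact hqk.trans (min_le_right _ _)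
  refine (measureReal_abs_dual_gt_le_integral_charFunDual L hr).trans ?_
  have hbd : ∀ t ∈ uIoc (-2 * r⁻¹) (2 * r⁻¹),
      ‖1 - charFunDual (convPow (η n) k) (t • L)‖ ≤ 2 * (q * M) := by
    intro t ht
    have hle : -2 * r⁻¹ ≤ 2 * r⁻¹ := by
      have : 0 < r⁻¹ := by positivity
      linarith
    rw [uIoc_of_le hle] at ht
    have h1 := hM t ⟨ht.1.le, ht.2⟩
    rw [((hexp n).convPow k).charFunDual_eq, norm_sub_rev]
    have h2 : ‖(k : ℂ) * (ψ (t • L) / 2 ^ n)‖ ≤ q * M := by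
      have : (k : ℂ) * (ψ (t • L) / 2 ^ n) = (q : ℂ) * ψ (t • L) := by
        rw [hq]; push_cast; ring
      rw [this, norm_mul, Complex.norm_real, Real.norm_of_nonneg hq0]
      exact mul_le_mul_of_nonneg_left h1 hq0
    have h3 := Complex.norm_exp_sub_one_le (x := (k : ℂ) * (ψ (t • L) / 2 ^ n))
      (h2.trans (by nlinarith))
    linarith
  have h4 := intervalIntegral.norm_integral_le_of_norm_le_const hbd
  have h5 : |2 * r⁻¹ - -2 * r⁻¹| = 4 * r⁻¹ := by
    rw [abs_of_nonneg (by have : 0 < r⁻¹ := by positivity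
                          linarith)]
    ring
  rw [h5] at h4
  calc 2⁻¹ * r * _ ≤ 2⁻¹ * r * (2 * (q * M) * (4 * r⁻¹)) := by gcongr
    _ = q * (4 * M) := by field_simp
    _ ≤ α := by nlinarith

variable [CompleteSpace E]

/-- The convolution powers `ν^{*k/2^n}`, `k ≤ 2^n`, of the dyadic roots of a law are uniformly
tight. -/
lemma exists_isCompact_convPow_compl_le {ν : Measure E} {η : ℕ → Measure E}
    [hη : ∀ n, IsProbabilityMeasure (η n)] (hsq : ∀ n, η (n + 1) ∗ η (n + 1) = η n) (h0 : η 0 = ν)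
    {α : ℝ≥0∞} (hα : 0 < α) :
    ∃ D : Set E, IsCompact D ∧ ∀ n k, k ≤ 2 ^ n → convPow (η n) k Dᶜ ≤ α := by
  have hνp : IsProbabilityMeasure ν := h0 ▸ hη 0
  have htight (j : ℕ) := isTightMeasureSet_iff_exists_isCompact_measure_compl_le.1
    (isTightMeasureSet_singleton (μ := ν)) ((1 / 4 : ℝ≥0∞) ^ (j + 2)) (ENNReal.pow_pos (by simp) _)
  choose C hCc hCν using htight
  have hCcl (j : ℕ) : IsClosed (C j) := (hCc j).isClosed
  -- a choice of centres for all factors of `ν`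
  have hcen (μ : Measure E) : ∃ c : E, IsProbabilityMeasure μ → (∃ μ' : Measure E,
      IsProbabilityMeasure μ' ∧ μ ∗ μ' = ν) →
        ∀ j, μ {x | x + c ∉ C j} ≤ (1 / 2 : ℝ≥0∞) ^ (j + 2) := by
    by_cases h : IsProbabilityMeasure μ ∧ ∃ μ' : Measure E, IsProbabilityMeasure μ' ∧ μ ∗ μ' = ν
    · obtain ⟨hμ, μ', hμ', hc⟩ := h
      obtain ⟨c, hc⟩ := exists_center hCcl (fun j => hCν j ν rfl) hc
      exact ⟨c, fun _ _ => hc⟩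
    · exact ⟨0, fun h1 h2 => absurd ⟨h1, h2⟩ h⟩
  choose c hc using hcen
  have hpow (n : ℕ) : convPow (η n) (2 ^ n) = ν := by
    induction n with
    | zero => rw [pow_zero, convPow_one, h0]
    | succ n ih => rw [pow_succ', convPow_mul, convPow_two, hsq, ih]
  have hfac (n k : ℕ) (hk : k ≤ 2 ^ n) : ∃ μ' : Measure E, IsProbabilityMeasure μ' ∧
      convPow (η n) k ∗ μ' = ν :=
    ⟨convPow (η n) (2 ^ n - k), inferInstance, by
      rw [← convPow_add, Nat.add_sub_cancel' hk, hpow]⟩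
  have hcC (n k : ℕ) (hk : k ≤ 2 ^ n) := hc (convPow (η n) k) inferInstance (hfac n k hk)
  have hquarter : (1 / 2 : ℝ≥0∞) ^ (0 + 2) ≤ 1 / 4 := by
    rw [zero_add, sq, one_div, one_div, ← ENNReal.mul_inv (by simp) (by simp)]
    norm_num
  set K₀ : Set E := (C 0 + C 0 - C 0) ∪ {c ν} with hK₀
  have hK₀c : IsCompact K₀ := by
    rw [hK₀, sub_eq_add_neg]
    exact (((hCc 0).add (hCc 0)).add (hCc 0).neg).union isCompact_singleton
  -- Convexity gives `p K + q K = (p + q) K`, so membership estimates for the centres behave like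
  -- norm bounds. Completeness keeps the closed hull compact.
  set K : Set E := closure (convexHull ℝ (K₀ ∪ -K₀)) with hK
  have hKc : IsCompact K :=
    ((hK₀c.union hK₀c.neg).totallyBounded.convexHull).closure.isCompact_of_isClosed isClosed_closure
  have hKconv : Convex ℝ K := (convex_convexHull ℝ _).closure
  have hsub : K₀ ∪ -K₀ ⊆ K := (subset_convexHull ℝ _).trans subset_closure
  have hKadd (p q : ℝ) (hp : 0 ≤ p) (hq : 0 ≤ q) {x y : E} (hx : x ∈ p • K) (hy : y ∈ q • K) :
      x + y ∈ (p + q) • K := by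
    rw [hKconv.add_smul hp hq]; exact add_mem_add hx hy
  have hdiff (n k l : ℕ) (hkl : k + l ≤ 2 ^ n) : ∀ x, x = c (convPow (η n) k) +
      c (convPow (η n) l) - c (convPow (η n) (k + l)) → x ∈ K ∧ -x ∈ K := by
    rintro x rfl
    have h1 := center_add_sub_mem ((hcC n k (by omega) 0).trans hquarter)
      ((hcC n l (by omega) 0).trans hquarter) (hCcl 0)
      (c := c (convPow (η n) (k + l)))
      (by rw [← convPow_add]; exact (hcC n (k + l) hkl 0).trans hquarter)
    exact ⟨hsub (Or.inl (Or.inl h1)), hsub (Or.inr (by rw [Set.mem_neg, neg_neg]; exact Or.inl h1))⟩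
  have hcν : c ν ∈ K := hsub (Or.inl (Or.inr rfl))
  have hhalf (p : ℝ) {x : E} (hx : x + x ∈ (2 * p) • K) : x ∈ p • K := by
    rw [mul_smul] at hx
    obtain ⟨y, hy, hxy⟩ := hx
    have : x = y := by
      have h2 : (2 : ℝ) • y = (2 : ℝ) • x := by rw [two_smul ℝ x]; exact hxy
      exact (smul_right_injective E (two_ne_zero (α := ℝ)) h2).symm
    rwa [this]
  have hone {x : E} (hx : x ∈ K) : x ∈ (1 : ℝ) • K := by rwa [one_smul]
  -- Centres were assigned to measures rather than to pairs `(n, k)`, so this equality also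
  -- identifies the centres at the two levels.
  have hdouble (n k : ℕ) : convPow (η (n + 1)) (k + k) = convPow (η n) k := by
    rw [← two_mul, convPow_mul, convPow_two, hsq]
  -- The constant `5` reproduces itself under refinement. In the first half of the grid, twice the
  -- new centre is an old centre plus an error, so it lies in `(1 + 5) K` and the centre in `3 K`.
  -- The midpoint centre lies in `K`, and for later points midpoint, remainder and error add up to
  -- `1 + 3 + 1 = 5`.
  have hbound (n : ℕ) : ∀ k ≤ 2 ^ n, c (convPow (η n) k) ∈ (5 : ℝ) • K := by
    have hmono {p : ℝ} (hp : 0 ≤ p) (hp5 : p ≤ 5) {x : E} (hx : x ∈ p • K) (h0 : (0 : E) ∈ K) :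
        x ∈ (5 : ℝ) • K := by
      have h1 := hKadd p (5 - p) hp (by linarith) hx ⟨0, h0, smul_zero _⟩
      rwa [add_zero, add_sub_cancel] at h1
    have hz : (0 : E) ∈ K := by
      have h1 := hKconv hcν (hsub (Or.inr (by simp [hK₀])) : -c ν ∈ K)
        (a := 1 / 2) (b := 1 / 2) (by norm_num) (by norm_num) (by norm_num)
      simpa using h1
    induction n with
    | zero =>
      intro k hk
      rw [pow_zero] at hk
      obtain rfl | rfl : k = 0 ∨ k = 1 := by omega
      · have h1 := (hdiff 0 0 0 (by simp) _ rfl).1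
        rw [add_zero, add_sub_cancel_right] at h1
        exact hmono zero_le_one (by norm_num) (hone h1) hz
      · rw [convPow_one, h0]
        exact hmono zero_le_one (by norm_num) (hone hcν) hz
    | succ n ih =>
      have hsmall (k : ℕ) (hk : k ≤ 2 ^ n) : c (convPow (η (n + 1)) k) ∈ (3 : ℝ) • K := by
        have h1 := (hdiff (n + 1) k k (by rw [pow_succ]; omega) _ rfl).1
        rw [hdouble] at h1
        have h2 := hKadd 1 5 (by norm_num) (by norm_num) (hone h1) (ih k hk)
        rw [sub_add_cancel, show (1 + 5 : ℝ) = 2 * 3 by norm_num] at h2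
        exact hhalf 3 h2
      intro k hk
      rcases le_or_gt k (2 ^ n) with hkn | hkn
      · exact hmono (by norm_num) (by norm_num) (hsmall k hkn) hz
      · obtain ⟨m, rfl⟩ := Nat.exists_eq_add_of_le hkn.le
        have hm : m ≤ 2 ^ n := by rw [pow_succ] at hk; omega
        have h1 := (hdiff (n + 1) (2 ^ n) (2 ^ n) (by rw [pow_succ]; omega) _ rfl).1
        rw [hdouble, hpow] at h1
        have h2 := hKadd 1 1 (by norm_num) (by norm_num) (hone h1) (hone hcν)
        rw [sub_add_cancel, show (1 + 1 : ℝ) = 2 * 1 by norm_num] at h2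
        have h3 := hhalf 1 h2
        have h4 := (hdiff (n + 1) (2 ^ n) m (by rw [pow_succ]; omega) _ rfl).2
        have h5 := hKadd _ _ (by norm_num) (by norm_num)
          (hKadd 1 3 (by norm_num) (by norm_num) h3 (hsmall m hm)) (hone h4)
        rw [neg_sub, add_sub_cancel, show (1 + 3 + 1 : ℝ) = 5 by norm_num] at h5
        exact h5
  obtain ⟨j, hj⟩ := ((ENNReal.tendsto_pow_atTop_nhds_zero_of_lt_one
    (show (1 / 2 : ℝ≥0∞) < 1 by simp)).eventually (gt_mem_nhds hα)).exists
  -- If `x + c ∈ C j` with `c ∈ 5 K`, then `x = (x + c) - c` lies in this compact set.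
  refine ⟨C j - (5 : ℝ) • K, by
    rw [sub_eq_add_neg]; exact (hCc j).add (hKc.smul _).neg, fun n k hk => ?_⟩
  refine (measure_mono fun x hx => ?_).trans ((hcC n k hk j).trans
    ((pow_le_pow_of_le_one (by simp) (by simp) (by omega)).trans hj.le))
  intro hmem
  exact hx ⟨_, hmem, _, hbound n k hk, by simp⟩

/-- The convolution semigroup of dyadic powers of an infinitely divisible law is continuous at
time zero. -/
lemma exists_norm_tail_le {ν : Measure E} {ψ : StrongDual ℝ E → ℂ} (hψ : IsExponent ν ψ)
    {η : ℕ → Measure E} [hη : ∀ n, IsProbabilityMeasure (η n)]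
    (hsq : ∀ n, η (n + 1) ∗ η (n + 1) = η n) (h0 : η 0 = ν)
    (hexp : ∀ n, IsExponent (η n) (fun L => ψ L / 2 ^ n)) {ε α : ℝ}
    (hε : 0 < ε) (hα : 0 < α) :
    ∃ δ : ℝ, 0 < δ ∧ ∀ n k : ℕ, k ≤ δ * 2 ^ n →
      (convPow (η n) k).real {x | ε < ‖x‖} ≤ α := by
  obtain ⟨D, hDc, hD⟩ := exists_isCompact_convPow_compl_le hsq h0
    (α := ENNReal.ofReal (α / 2)) (by simpa using hα)
  have hsep (x : E) : ∃ L : StrongDual ℝ E, x ≠ 0 → L x ≠ 0 := by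
    by_cases hx : x = 0
    · exact ⟨0, fun h => absurd hx h⟩
    · obtain ⟨L, hL⟩ := SeparatingDual.exists_ne_zero (R := ℝ) hx
      exact ⟨L, fun _ => hL⟩
  choose L hL using hsep
  set D' : Set E := D ∩ {x | ε ≤ ‖x‖}
  have hD'c : IsCompact D' := hDc.inter_right (isClosed_le continuous_const continuous_norm)
  -- The part of the tight compact set away from `0` is covered by finitely many half-space pairs,
  -- so norm tails reduce to finitely many one-dimensional tails. Half of `α` pays for the
  -- complement of `D`, half for these.
  obtain ⟨t, ht⟩ := hD'c.elim_finite_subcover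
    (fun x : {x : E // x ≠ 0} => {y | |L x.1 x.1| / 2 < |L x.1 y|})
    (fun x => isOpen_lt continuous_const (by fun_prop)) (fun x hx => by
      have hx0 : x ≠ 0 := norm_pos_iff.1 (hε.trans_le hx.2)
      refine mem_iUnion.2 ⟨⟨x, hx0⟩, ?_⟩
      have := abs_pos.2 (hL x hx0)
      simp only [mem_ofPred_eq]
      linarith)
  have htail (x : {x : E // x ≠ 0}) := exists_dual_tail_le hψ hexp (L x.1)
    (r := |L x.1 x.1| / 2) (α := α / 2 / (t.card + 1))
    (half_pos (abs_pos.2 (hL x.1 x.2))) (by positivity)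
  choose δ hδ hδt using htail
  obtain ⟨δ₀, hδ₀, hδ₀le⟩ : ∃ δ₀ : ℝ, 0 < δ₀ ∧ ∀ x ∈ t, δ₀ ≤ δ x := by
    rcases t.eq_empty_or_nonempty with h | h
    · exact ⟨1, one_pos, by simp [h]⟩
    · exact ⟨t.inf' h δ, by simpa [Finset.lt_inf'_iff] using fun x hx _ => hδ ⟨x, hx⟩,
        fun x hx => Finset.inf'_le _ hx⟩
  -- The cap at `1` ensures `k ≤ 2ⁿ`, the range in which tightness is known.
  refine ⟨min δ₀ 1, by positivity, fun n k hk => ?_⟩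
  have hpos : (0 : ℝ) < 2 ^ n := by positivity
  have hk1 : k ≤ 2 ^ n := by
    have : (k : ℝ) ≤ 2 ^ n := hk.trans (by nlinarith [min_le_right δ₀ 1])
    exact_mod_cast this
  have hsubset : {x : E | ε < ‖x‖} ⊆ Dᶜ ∪ ⋃ x ∈ t, {y | |L x.1 x.1| / 2 < |L x.1 y|} := by
    intro x hx
    by_cases hxD : x ∈ D
    · exact Or.inr (ht ⟨hxD, le_of_lt (show ε < ‖x‖ from hx)⟩)
    · exact Or.inl hxD
  calc (convPow (η n) k).real {x | ε < ‖x‖}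
      ≤ (convPow (η n) k).real Dᶜ + ∑ x ∈ t, (convPow (η n) k).real
          {y | |L x.1 x.1| / 2 < |L x.1 y|} :=
        (measureReal_mono hsubset).trans ((measureReal_union_le _ _).trans
          (by gcongr; exact measureReal_biUnion_finset_le _ _))
    _ ≤ α / 2 + ∑ x ∈ t, α / 2 / (t.card + 1) := by
        refine add_le_add ?_ (Finset.sum_le_sum fun x hx => hδt x n k (hk.trans ?_))
        · exact ENNReal.toReal_le_of_le_ofReal (by positivity) (hD n k hk1)
        · have := min_le_left δ₀ 1
          have := hδ₀le x hx
          nlinarith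
    _ ≤ α := by
        rw [Finset.sum_const, nsmul_eq_mul]
        have : (t.card : ℝ) * (α / 2 / (t.card + 1)) ≤ α / 2 := by
          rw [mul_div_assoc', div_le_iff₀ (by positivity)]
          nlinarith
        linarith

end Concentration

/-! ### Chains of large moves and successive exits of a walk. -/

section Jumps

variable {E : Type*} [NormedAddCommGroup E]

/-- `HasJumps f r A p s`: there are points `s = s₀ < s₁ < ⋯ < s_p` of `A` such that `f` moves by
more than `r` between consecutive ones. -/
def HasJumps {ι : Type*} [LT ι] (f : ι → E) (r : ℝ) (A : Set ι) : ℕ → ι → Prop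
  | 0, s => s ∈ A
  | p + 1, s => s ∈ A ∧ ∃ t, s < t ∧ r < ‖f t - f s‖ ∧ HasJumps f r A p t

lemma HasJumps.mem {ι : Type*} [LT ι] {f : ι → E} {r : ℝ} {A : Set ι} {p : ℕ} {s : ι}
    (h : HasJumps f r A p s) : s ∈ A := by
  cases p with
  | zero => exact h
  | succ p => exact h.1

lemma HasJumps.mono {ι : Type*} [LT ι] {f : ι → E} {r : ℝ} {A B : Set ι} (hAB : A ⊆ B) {p : ℕ}
    {s : ι} (h : HasJumps f r A p s) : HasJumps f r B p s := by
  induction p generalizing s with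
  | zero => exact hAB h
  | succ p ih =>
    obtain ⟨hs, t, hst, hr, ht⟩ := h
    exact ⟨hAB hs, t, hst, hr, ih ht⟩

lemma HasJumps.exists_of_iUnion {ι : Type*} [LT ι] {f : ι → E} {r : ℝ} {A : ℕ → Set ι}
    (hA : Monotone A) {p : ℕ} {s : ι} (h : HasJumps f r (⋃ n, A n) p s) :
    ∃ n, HasJumps f r (A n) p s := by
  induction p generalizing s with
  | zero => exact mem_iUnion.1 h
  | succ p ih =>
    obtain ⟨hs, t, hst, hr, ht⟩ := h
    obtain ⟨n, hn⟩ := mem_iUnion.1 hs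
    obtain ⟨m, hm⟩ := ih ht
    exact ⟨max n m, hA (le_max_left _ _) hn, t, hst, hr, hm.mono (hA (le_max_right _ _))⟩

/-- `Crosses ε n x d p`: starting from the deviation `d`, the walk with steps `x` leaves the ball of
radius `ε` at least `p` times, the deviation being reset to zero after each exit. -/
def Crosses (ε : ℝ) : (n : ℕ) → (Fin n → E) → E → ℕ → Prop
  | _, _, _, 0 => True
  | 0, _, _, _ + 1 => False
  | n + 1, x, d, p + 1 => (ε < ‖d + x 0‖ ∧ Crosses ε n (Fin.tail x) 0 p) ∨
      (‖d + x 0‖ ≤ ε ∧ Crosses ε n (Fin.tail x) (d + x 0) (p + 1))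

lemma crosses_zero (ε : ℝ) (n : ℕ) (x : Fin n → E) (d : E) : Crosses ε n x d 0 := by
  simp [Crosses]

lemma Crosses.of_succ {ε : ℝ} {n : ℕ} {x : Fin n → E} {d : E} {p : ℕ}
    (h : Crosses ε n x d (p + 1)) : Crosses ε n x d p := by
  induction n generalizing d p with
  | zero => exact h.elim
  | succ n ih =>
    cases p with
    | zero => exact crosses_zero _ _ _ _
    | succ p =>
      rcases h with ⟨h1, h2⟩ | ⟨h1, h2⟩
      · exact Or.inl ⟨h1, ih h2⟩
      · exact Or.inr ⟨h1, ih h2⟩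

lemma HasJumps.shift {f : ℕ → E} {r : ℝ} {N p s : ℕ} (h : HasJumps f r (Iic (N + 1)) p (s + 1)) :
    HasJumps (fun i => f (i + 1)) r (Iic N) p s := by
  induction p generalizing s with
  | zero => exact Nat.le_of_succ_le_succ h
  | succ p ih =>
    obtain ⟨hs, t, hst, hr, ht⟩ := h
    obtain ⟨t, rfl⟩ := Nat.exists_eq_add_of_lt (Nat.zero_lt_of_lt hst)
    rw [zero_add] at *
    exact ⟨Nat.le_of_succ_le_succ hs, t, Nat.lt_of_succ_lt_succ hst, hr, ih ht⟩

/-- Peel off one step of the walk. If it exits, the walk restarts at `f 1`; two consecutive points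
of the chain are more than `2 ε` apart, so one of them is more than `ε` from `f 1`. Restarting the
argument there loses at most one crossing. If it does not exit, the deviation is carried along
unchanged in meaning. -/
lemma HasJumps.crosses_of_lt {ε : ℝ} (hε : 0 ≤ ε) {N : ℕ} {f : ℕ → E} {d : E} {p s : ℕ}
    (h : HasJumps f (2 * ε) (Iic N) p s) (hd : ‖d‖ ≤ ε) (hs : ε < ‖d + (f s - f 0)‖) :
    Crosses ε N (fun i => f (i + 1) - f i) d (p + 1) := by
  induction N generalizing f d p s with
  | zero =>
    obtain rfl : s = 0 := Nat.le_zero.1 h.mem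
    simp only [sub_self, add_zero] at hs
    exact absurd hd hs.not_ge
  | succ N ih =>
    rcases s with - | s
    · simp only [sub_self, add_zero] at hs
      exact absurd hd hs.not_ge
    have h' := h.shift
    have htail : Fin.tail (fun i : Fin (N + 1) => f (i + 1) - f i) =
        fun i : Fin N => (fun j => f (j + 1)) (i + 1) - (fun j => f (j + 1)) (i : ℕ) := by
      ext i; simp [Fin.tail]
    by_cases hd' : ε < ‖d + (f 1 - f 0)‖
    · refine Or.inl ⟨by simpa using hd', ?_⟩
      rw [htail]
      cases p with
      | zero => exact crosses_zero _ _ _ _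
      | succ p =>
        obtain ⟨-, t, -, hr, ht⟩ := id h'
        by_cases hct : ε < ‖f (t + 1) - f 1‖
        · exact ih ht (by simpa using hε) (by simpa using hct)
        · have hcs : ε < ‖f (s + 1) - f 1‖ := by
            have := norm_sub_le (f (t + 1) - f 1) (f (s + 1) - f 1)
            rw [sub_sub_sub_cancel_right] at this
            push Not at hct
            linarith
          exact (ih h' (by simpa using hε) (by simpa using hcs)).of_succ
    · push Not at hd'
      refine Or.inr ⟨by simpa using hd', ?_⟩
      rw [htail]
      have := ih (d := d + (f 1 - f 0)) h' hd' (by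
        simpa only [add_assoc, zero_add, sub_add_sub_cancel'] using hs)
      simpa using this

lemma HasJumps.crosses {ε : ℝ} (hε : 0 ≤ ε) {N : ℕ} {f : ℕ → E} {p s : ℕ}
    (h : HasJumps f (2 * ε) (Iic N) p s) :
    Crosses ε N (fun i => f (i + 1) - f i) 0 p := by
  cases p with
  | zero => exact crosses_zero _ _ _ _
  | succ p =>
    obtain ⟨-, t, -, hr, ht⟩ := id h
    by_cases hct : ε < ‖f t - f 0‖
    · exact ht.crosses_of_lt hε (by simpa using hε) (by simpa using hct)
    · have hcs : ε < ‖f s - f 0‖ := by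
        have := norm_sub_le (f t - f 0) (f s - f 0)
        rw [sub_sub_sub_cancel_right] at this
        push Not at hct
        linarith
      exact (h.crosses_of_lt hε (by simpa using hε) (by simpa using hcs)).of_succ

end Jumps

/-! ### Ottaviani's inequality and geometric tails for crossings. -/

section RandomWalk

open scoped ENNReal

variable {E : Type*} [NormedAddCommGroup E] [SecondCountableTopology E] [MeasurableSpace E]
  [BorelSpace E]

/-- Joint measurability in the deviation and the steps is what makes crossing probabilities
measurable functions of the first step. -/
lemma measurableSet_crosses (ε : ℝ) (n p : ℕ) :
    MeasurableSet {z : E × (Fin n → E) | Crosses ε n z.2 z.1 p} := by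
  induction n generalizing p with
  | zero =>
    cases p with
    | zero => simp [crosses_zero]
    | succ p => simp [Crosses]
  | succ n ih =>
    cases p with
    | zero => simp [crosses_zero]
    | succ p =>
      have htail : Measurable fun z : E × (Fin (n + 1) → E) => Fin.tail z.2 :=
        measurable_pi_iff.2 fun i => (measurable_pi_apply _).comp measurable_snd
      have h0 : Measurable fun z : E × (Fin (n + 1) → E) => z.1 + z.2 0 := by fun_prop
      refine MeasurableSet.union (MeasurableSet.inter ?_ ?_) (MeasurableSet.inter ?_ ?_)
      · exact measurableSet_lt measurable_const h0.norm
      · exact (measurable_const.prodMk htail) (ih p)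
      · exact measurableSet_le h0.norm measurable_const
      · exact (h0.prodMk htail) (ih (p + 1))

lemma measurableSet_crosses_right (ε : ℝ) (n : ℕ) (d : E) (p : ℕ) :
    MeasurableSet {x : Fin n → E | Crosses ε n x d p} :=
  measurable_prodMk_left (measurableSet_crosses ε n p)

lemma pi_succ_apply {E : Type*} [MeasurableSpace E] (μ : Measure E) [IsProbabilityMeasure μ]
    {n : ℕ} {S : Set (Fin (n + 1) → E)}
    (hS : MeasurableSet S) :
    Measure.pi (fun _ : Fin (n + 1) => μ) S =
      ∫⁻ ξ, Measure.pi (fun _ : Fin n => μ) {x | (Fin.cons ξ x : Fin (n + 1) → E) ∈ S} ∂μ := by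
  have h := (measurePreserving_piFinSuccAbove (fun _ : Fin (n + 1) => μ) 0).symm
  rw [← h.measure_preimage_equiv, Measure.prod_apply ((MeasurableEquiv.measurable _) hS)]
  congr with ξ
  simp [preimage, MeasurableEquiv.piFinSuccAbove, Fin.consEquiv]

variable (μ : Measure E) [IsProbabilityMeasure μ]

lemma pi_crosses_succ (ε : ℝ) (n : ℕ) (d : E) (p : ℕ) :
    Measure.pi (fun _ : Fin (n + 1) => μ) {x | Crosses ε (n + 1) x d (p + 1)} =
      ∫⁻ ξ, (if ε < ‖d + ξ‖ then Measure.pi (fun _ : Fin n => μ) {x | Crosses ε n x 0 p}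
        else Measure.pi (fun _ : Fin n => μ) {x | Crosses ε n x (d + ξ) (p + 1)}) ∂μ := by
  rw [pi_succ_apply μ (measurableSet_crosses_right ε _ d _)]
  congr with ξ
  split_ifs with h
  · congr with x
    simp [Crosses, h, h.not_ge]
  · congr with x
    simp [Crosses, h, not_lt.1 h]

/-- A strong Markov argument by conditioning on the first step: each exit resets the deviation to
zero, so every crossing after the first costs a factor `q`. -/
lemma pi_crosses_le_mul {ε : ℝ} {N : ℕ} {q : ℝ≥0∞}
    (hq : ∀ n ≤ N, Measure.pi (fun _ : Fin n => μ) {x | Crosses ε n x 0 1} ≤ q) {n : ℕ}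
    (hn : n ≤ N) (d : E) (p : ℕ) :
    Measure.pi (fun _ : Fin n => μ) {x | Crosses ε n x d (p + 1)} ≤
      Measure.pi (fun _ : Fin n => μ) {x | Crosses ε n x d 1} * q ^ p := by
  induction n generalizing d p with
  | zero => simp [Crosses]
  | succ n ih =>
    cases p with
    | zero => simp
    | succ p =>
      have hm : Measurable fun ξ : E => (if ε < ‖d + ξ‖ then
          Measure.pi (fun _ : Fin n => μ) {x | Crosses ε n x 0 0}
          else Measure.pi (fun _ : Fin n => μ) {x | Crosses ε n x (d + ξ) 1}) := by
        refine Measurable.ite (measurableSet_lt measurable_const (by fun_prop))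
          measurable_const ?_
        exact (measurable_measure_prodMk_left (measurableSet_crosses ε n 1)).comp
          (measurable_const_add d)
      rw [pi_crosses_succ, pi_crosses_succ, ← lintegral_mul_const _ hm]
      refine lintegral_mono fun ξ => ?_
      split_ifs with h
      · calc _ ≤ _ := ih (by omega) 0 p
          _ ≤ q * q ^ p := by gcongr; exact hq n (by omega)
          _ = _ := by rw [← pow_succ']; simp [crosses_zero]
      · exact ih (by omega) _ (p + 1)

/-- Ottaviani's maximal inequality. -/
lemma pi_crosses_one_mul_le {ε : ℝ} {N : ℕ} {β : ℝ≥0∞}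
    (hβ : ∀ n ≤ N, β ≤ Measure.pi (fun _ : Fin n => μ) {x | ‖∑ i, x i‖ ≤ ε / 2}) {n : ℕ}
    (hn : n ≤ N) (d : E) :
    Measure.pi (fun _ : Fin n => μ) {x | Crosses ε n x d 1} * β ≤
      Measure.pi (fun _ : Fin n => μ) {x | ε / 2 < ‖d + ∑ i, x i‖} := by
  induction n generalizing d with
  | zero => simp [Crosses]
  | succ n ih =>
    have hm : Measurable fun ξ : E => (if ε < ‖d + ξ‖ then
        Measure.pi (fun _ : Fin n => μ) {x | Crosses ε n x 0 0}
        else Measure.pi (fun _ : Fin n => μ) {x | Crosses ε n x (d + ξ) 1}) := by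
      refine Measurable.ite (measurableSet_lt measurable_const (by fun_prop))
        measurable_const ?_
      exact (measurable_measure_prodMk_left (measurableSet_crosses ε n 1)).comp
        (measurable_const_add d)
    rw [pi_crosses_succ, ← lintegral_mul_const _ hm,
      pi_succ_apply μ (measurableSet_lt measurable_const (by fun_prop))]
    refine lintegral_mono fun ξ => ?_
    simp only [mem_ofPred_eq, Fin.sum_univ_succ, Fin.cons_zero, Fin.cons_succ, ← add_assoc]
    split_ifs with h
    -- The walk has just exited: if the remaining steps sum to at most `ε / 2`, which has
    -- probability at least `β`, the endpoint is still beyond `ε / 2`.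
    · simp only [crosses_zero, ofPred_true, measure_univ, one_mul]
      refine (hβ n (by omega)).trans (measure_mono fun x hx => ?_)
      have h1 : ‖∑ i, x i‖ ≤ ε / 2 := hx
      have h2 := norm_sub_le (d + ξ + ∑ i, x i) (∑ i, x i)
      rw [add_sub_cancel_right] at h2
      show ε / 2 < ‖d + ξ + ∑ i, x i‖
      linarith
    · exact ih (by omega) (d + ξ)

variable [NormedSpace ℝ E] [CompleteSpace E]

lemma map_sum_pi (n : ℕ) :
    (Measure.pi (fun _ : Fin n => μ)).map (fun x => ∑ i, x i) = convPow μ n := by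
  have : IsProbabilityMeasure ((Measure.pi (fun _ : Fin n => μ)).map (fun x => ∑ i, x i)) :=
    Measure.isProbabilityMeasure_map (by fun_prop)
  refine Measure.ext_of_charFunDual ?_
  rw [charFunDual_map_sum_pi_eq_prod]
  ext L
  simp [charFunDual_convPow]

/-- The number of crossings of a random walk with small increments has geometric tails. -/
lemma pi_crosses_le_pow {ε : ℝ} {N : ℕ}
    (h : ∀ n ≤ N, (convPow μ n).real {x | ε / 2 < ‖x‖} ≤ 1 / 3) (p : ℕ) :
    Measure.pi (fun _ : Fin N => μ) {x | Crosses ε N x 0 p} ≤ (1 / 2 : ℝ≥0∞) ^ p := by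
  have hms : MeasurableSet {x : E | ε / 2 < ‖x‖} := measurableSet_lt measurable_const (by fun_prop)
  have hlt (n : ℕ) (hn : n ≤ N) :
      (Measure.pi (fun _ : Fin n => μ)).real {x | ε / 2 < ‖∑ i, x i‖} ≤ 1 / 3 := by
    have := h n hn
    rw [← map_sum_pi, map_measureReal_apply (by fun_prop) hms] at this
    exact this
  have hge (n : ℕ) (hn : n ≤ N) : ENNReal.ofReal (2 / 3) ≤
      Measure.pi (fun _ : Fin n => μ) {x | ‖∑ i, x i‖ ≤ ε / 2} := by
    rw [ENNReal.ofReal_le_iff_le_toReal (by simp)]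
    have hc := probReal_compl_eq_one_sub (μ := Measure.pi (fun _ : Fin n => μ))
      (s := {x | ε / 2 < ‖∑ i, x i‖}) (measurableSet_lt measurable_const (by fun_prop))
    have hs : {x : Fin n → E | ε / 2 < ‖∑ i, x i‖}ᶜ = {x | ‖∑ i, x i‖ ≤ ε / 2} := by
      ext x; simp
    rw [hs] at hc
    have := hlt n hn
    change 2 / 3 ≤ (Measure.pi (fun _ : Fin n => μ)).real _
    rw [hc]
    linarith
  -- Ottaviani with `β = 2/3` and endpoint tail at most `1/3` bounds one crossing by `(1/3) / (2/3)
  -- = 1/2`.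
  have hone (n : ℕ) (hn : n ≤ N) :
      Measure.pi (fun _ : Fin n => μ) {x | Crosses ε n x 0 1} ≤ 1 / 2 := by
    have h1 := pi_crosses_one_mul_le μ hge hn 0
    simp only [zero_add] at h1
    have h2 : (Measure.pi (fun _ : Fin n => μ)).real {x | Crosses ε n x 0 1} * (2 / 3) ≤ 1 / 3 := by
      have h3 := ENNReal.toReal_mono (by simp) h1
      rw [ENNReal.toReal_mul, ENNReal.toReal_ofReal (by norm_num)] at h3
      exact h3.trans (hlt n hn)
    have h4 : (Measure.pi (fun _ : Fin n => μ)).real {x | Crosses ε n x 0 1} ≤ 1 / 2 := by linarith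
    rw [← ENNReal.ofReal_toReal (measure_ne_top _ {x | Crosses ε n x 0 1})]
    refine (ENNReal.ofReal_le_ofReal h4).trans ?_
    rw [ENNReal.ofReal_div_of_pos (by norm_num)]
    simp
  cases p with
  | zero => simpa using prob_le_one
  | succ p =>
    refine (pi_crosses_le_mul μ hone le_rfl 0 p).trans ?_
    rw [pow_succ']
    gcongr
    exact hone N le_rfl

end RandomWalk

/-! ### Inverse limits and consistent dyadic walks. -/

section InverseLimit

/-- Inverse limits of sequences of standard Borel probability spaces. -/
lemma exists_inverse_limit {X : ℕ → Type*} [∀ n, MeasurableSpace (X n)]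
    [∀ n, StandardBorelSpace (X n)] [∀ n, Nonempty (X n)] (μ : ∀ n, Measure (X n))
    [∀ n, IsProbabilityMeasure (μ n)] {p : ∀ n, X (n + 1) → X n} (hp : ∀ n, Measurable (p n))
    (hμ : ∀ n, (μ (n + 1)).map (p n) = μ n) :
    ∃ P : Measure (∀ n, X n), IsProbabilityMeasure P ∧ (∀ n, P.map (fun x => x n) = μ n) ∧
      ∀ᵐ x ∂P, ∀ n, p n (x (n + 1)) = x n := by
  -- The limit is the Ionescu-Tulcea law of a Markov chain. Its transition is the conditional law of
  -- a level `n + 1` point given its image at level `n`, so consecutive pairs are concentrated on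
  -- the graph of `p n`.
  let K (n : ℕ) : Kernel (X n) (X (n + 1)) := condDistrib id (p n) (μ (n + 1))
  let e (n : ℕ) : (∀ i : Finset.Iic n, X i) → X n := fun x => x ⟨n, Finset.mem_Iic.2 le_rfl⟩
  have he (n : ℕ) : Measurable (e n) := measurable_pi_apply _
  let κ (n : ℕ) : Kernel (∀ i : Finset.Iic n, X i) (X (n + 1)) := (K n).comap (e n) (he n)
  have : ∀ n, IsMarkovKernel (κ n) := fun n => by
    have : IsMarkovKernel (K n) := by simp only [K]; infer_instance
    exact Kernel.IsMarkovKernel.comap _ (he n)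
  let P := Kernel.trajMeasure (μ 0) κ
  have hKp (n : ℕ) : μ n ⊗ₘ K n = (μ (n + 1)).map fun y => (p n y, y) := by
    have := compProd_map_condDistrib (mβ := inferInstance) (X := p n) (Y := id)
      (μ := μ (n + 1)) aemeasurable_id
    rw [hμ n] at this
    exact this
  have hpair (n : ℕ) (hn : P.map (fun x => x n) = μ n) :
      P.map (fun x => (x n, x (n + 1))) = (μ (n + 1)).map fun y => (p n y, y) := by
    have h1 := Kernel.map_frestrictLe_trajMeasure_compProd_eq_map_trajMeasure (μ₀ := μ 0) (κ := κ)
      (a := n)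
    have hf : Measurable (Preorder.frestrictLe (π := X) n) := by fun_prop
    have h2 : P.map (fun x => (x n, x (n + 1))) =
        (P.map (fun x => (Preorder.frestrictLe n x, x (n + 1)))).map (Prod.map (e n) id) := by
      rw [Measure.map_map (by fun_prop) (by fun_prop)]
      rfl
    rw [h2, ← h1, ← hKp, ← hn]
    have h3 : P.map (fun x => x n) = (P.map (Preorder.frestrictLe n)).map (e n) := by
      rw [Measure.map_map (he n) hf]; rfl
    have : IsProbabilityMeasure (P.map (Preorder.frestrictLe (π := X) n)) :=
      Measure.isProbabilityMeasure_map hf.aemeasurable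
    have : IsProbabilityMeasure ((P.map (Preorder.frestrictLe (π := X) n)).map (e n)) :=
      Measure.isProbabilityMeasure_map (he n).aemeasurable
    rw [h3]
    ext s hs
    rw [Measure.map_apply (by fun_prop) hs, Measure.compProd_apply (by measurability),
      Measure.compProd_apply hs,
      lintegral_map (Kernel.measurable_kernel_prodMk_left hs) (he n)]
    rfl
  have hlaw (n : ℕ) : P.map (fun x => x n) = μ n := by
    induction n with
    | zero =>
      have h1 : P.map (Preorder.frestrictLe (π := X) 0) =
          (μ 0).map (MeasurableEquiv.piUnique (fun i : Finset.Iic 0 => X i)).symm := by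
        simp only [P, Kernel.trajMeasure]
        rw [Measure.map_comp _ _ (by fun_prop), Kernel.traj_map_frestrictLe,
          Kernel.partialTraj_self, Measure.id_comp]
        rfl
      have h2 : P.map (fun x => x 0) = (P.map (Preorder.frestrictLe 0)).map (e 0) := by
        rw [Measure.map_map (he 0) (by fun_prop)]; rfl
      rw [h2, h1]
      exact (Measure.map_map (he 0) (MeasurableEquiv.measurable _)).trans Measure.map_id
    | succ n ih =>
      have h1 : P.map (fun x => x (n + 1)) = (P.map (fun x => (x n, x (n + 1)))).map Prod.snd := by
        rw [Measure.map_map (by fun_prop) (by fun_prop)]; rfl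
      rw [h1, hpair n ih, Measure.map_map (by fun_prop) (by fun_prop)]
      exact Measure.map_id
  refine ⟨P, by infer_instance, hlaw, ae_all_iff.2 fun n => ?_⟩
  have h1 : ∀ᵐ z ∂((μ (n + 1)).map fun y => (p n y, y)), p n z.2 = z.1 := by
    have hm : MeasurableSet {z : X n × X (n + 1) | p n z.2 = z.1} :=
      measurableSet_eq_fun ((hp n).comp measurable_snd) measurable_fst
    rw [ae_map_iff (by fun_prop) hm]
    exact ae_of_all _ fun _ => rfl
  rw [← hpair n (hlaw n)] at h1
  exact ae_of_ae_map (Measurable.aemeasurable (by fun_prop)) h1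

/-- Grouping an independent family into disjoint blocks gives an independent family. -/
lemma ProbabilityTheory.iIndepFun_curry {Ω ι : Type*} [MeasurableSpace Ω] {P : Measure Ω}
    {κ : ι → Type*} {F : Type*} [MeasurableSpace F] {X : (i : ι) → κ i → Ω → F}
    (mX : ∀ i j, Measurable (X i j))
    (h : iIndepFun (fun (p : Σ i, κ i) ω => X p.1 p.2 ω) P) :
    iIndepFun (fun i ω j => X i j ω) P := by
  have := h.isProbabilityMeasure
  have : ∀ i j, IsProbabilityMeasure (P.map (X i j)) :=
    fun i j => Measure.isProbabilityMeasure_map (mX i j).aemeasurable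
  have hc : (MeasurableEquiv.piCurry fun i (_ : κ i) => F) ∘
      (fun ω (p : Σ i, κ i) => X p.1 p.2 ω) = fun ω i j => X i j ω := by
    ext; simp [Sigma.curry]
  rw [iIndepFun_iff_map_fun_eq_infinitePi_map (fun i => by fun_prop), ← hc,
    ← Measure.map_map (by fun_prop) (by fun_prop),
    (iIndepFun_iff_map_fun_eq_infinitePi_map (X := fun (p : Σ i, κ i) ω => X p.1 p.2 ω)
      (fun p => mX p.1 p.2)).1 h,
    Measure.infinitePi_map_piCurry (fun i j => P.map (X i j))]
  congrm Measure.infinitePi fun i => ?_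
  have hi : iIndepFun (X i) P :=
    h.precomp (g := fun j => ⟨i, j⟩) (fun a b hab => by simpa using hab)
  exact ((iIndepFun_iff_map_fun_eq_infinitePi_map (mX i)).1 hi).symm

/-- Monotonicity of `t` makes the blocks disjoint, possibly empty, so the sums are functions of
disjoint subfamilies. -/
lemma ProbabilityTheory.iIndepFun.sum_Ico {Ω F : Type*} [MeasurableSpace Ω] {P : Measure Ω}
    [MeasurableSpace F] [AddCommMonoid F] [MeasurableAdd₂ F] {X : ℕ → Ω → F} (hX : iIndepFun X P)
    (mX : ∀ i, Measurable (X i)) {t : ℕ → ℕ} (ht : Monotone t) :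
    iIndepFun (fun i ω => ∑ j ∈ Finset.Ico (t i) (t (i + 1)), X j ω) P := by
  have hinj : Function.Injective
      (fun p : (Σ i : ℕ, (Finset.Ico (t i) (t (i + 1)) : Finset ℕ)) => (p.2 : ℕ)) := by
    have key (i i' a : ℕ) (h : i < i') (h1 : a < t (i + 1)) (h2 : t i' ≤ a) : False :=
      absurd (ht (Nat.succ_le_of_lt h)) (by simp only [Nat.succ_eq_add_one]; omega)
    rintro ⟨i, a, ha⟩ ⟨i', a', ha'⟩ h
    simp only at h
    subst h
    rw [Finset.mem_Ico] at ha ha'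
    obtain h | rfl | h := lt_trichotomy i i'
    · exact (key i i' a h ha.2 ha'.1).elim
    · rfl
    · exact (key i' i a h ha'.2 ha.1).elim
  have h1 := iIndepFun_curry (X := fun i (j : (Finset.Ico (t i) (t (i + 1)) : Finset ℕ)) => X j)
    (fun i j => mX j) (hX.precomp hinj)
  have h2 := h1.comp (fun i x => ∑ j, x j) (fun i => by fun_prop)
  refine h2.congr fun i => ae_of_all _ fun ω => ?_
  exact Finset.sum_coe_sort _ fun j => X j ω

variable {E : Type*} [NormedAddCommGroup E] [SecondCountableTopology E]
  [MeasurableSpace E] [BorelSpace E]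

/-- The consistency condition of the inverse limit: merging neighbouring steps turns a walk with
step law `η (n + 1)` into one with step law `η n`. -/
lemma map_pair_sum_infinitePi (μ : Measure E) [IsProbabilityMeasure μ] :
    (Measure.infinitePi fun _ : ℕ => μ).map (fun x k => x (2 * k) + x (2 * k + 1)) =
      Measure.infinitePi fun _ : ℕ => μ ∗ μ := by
  have hind : iIndepFun (fun (i : ℕ) (x : ℕ → E) => x i) (Measure.infinitePi fun _ : ℕ => μ) :=
    iIndepFun_infinitePi (X := fun _ x => x) (fun _ => measurable_id)
  have h2 := hind.sum_Ico (fun i => measurable_pi_apply i) (t := fun i => 2 * i)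
    (fun a b h => by simp only; omega)
  have h4 (i : ℕ) (x : ℕ → E) :
      ∑ j ∈ Finset.Ico (2 * i) (2 * (i + 1)), x j = x (2 * i) + x (2 * i + 1) := by
    rw [show 2 * (i + 1) = 2 * i + 1 + 1 by ring, Finset.sum_Ico_succ_top (by omega),
      Finset.sum_Ico_succ_top le_rfl]
    simp
  simp only [h4] at h2
  rw [iIndepFun_iff_map_fun_eq_infinitePi_map (fun k => by fun_prop)] at h2
  rw [h2]
  congr with k : 1
  have h3 := IndepFun.map_add_eq_map_conv_map (f := fun x : ℕ → E => x (2 * k))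
    (g := fun x : ℕ → E => x (2 * k + 1)) (by fun_prop) (by fun_prop)
    (hind.indepFun (show 2 * k ≠ 2 * k + 1 by omega))
  rw [Measure.infinitePi_map_eval, Measure.infinitePi_map_eval] at h3
  exact h3

variable [CompleteSpace E]

/-- Random walks on the dyadic grids, consistent under refinement. -/
lemma exists_dyadic_walks {η : ℕ → Measure E} [hη : ∀ n, IsProbabilityMeasure (η n)]
    (hsq : ∀ n, η (n + 1) ∗ η (n + 1) = η n) :
    ∃ P : Measure (ℕ → ℕ → E), IsProbabilityMeasure P ∧
      (∀ n, P.map (fun ω => ω n) = Measure.infinitePi fun _ : ℕ => η n) ∧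
      ∀ᵐ ω ∂P, ∀ n k, ω (n + 1) (2 * k) + ω (n + 1) (2 * k + 1) = ω n k := by
  obtain ⟨P, hP, hlaw, hcons⟩ := exists_inverse_limit (X := fun _ => ℕ → E)
    (fun n => Measure.infinitePi fun _ : ℕ => η n)
    (p := fun _ x k => x (2 * k) + x (2 * k + 1)) (fun n => by fun_prop)
    (fun n => by rw [map_pair_sum_infinitePi, hsq])
  exact ⟨P, hP, hlaw, hcons.mono fun ω h n k => congrFun (h n) k⟩

end InverseLimit

/-! ### Càdlàg regularization of functions on the dyadics. -/

section Regularization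

/-- The dyadic points of level `n`. -/
def dyadicGrid (n : ℕ) : Set ℝ≥0 := {s | ∃ k : ℕ, s = k / 2 ^ n}

lemma monotone_dyadicGrid : Monotone dyadicGrid := by
  refine monotone_nat_of_le_succ fun n => ?_
  rintro _ ⟨k, rfl⟩
  refine ⟨2 * k, ?_⟩
  rw [pow_succ', Nat.cast_mul, Nat.cast_ofNat, mul_div_mul_left _ _ two_ne_zero]

/-- The set of dyadic points. -/
def dyadics : Set ℝ≥0 := ⋃ n, dyadicGrid n

lemma tendsto_gridNext_dyadics (t : ℝ≥0) :
    Tendsto (fun n : ℕ => gridNext (2 ^ n) t) atTop (𝓝[dyadics ∩ Ioi t] t) := by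
  have h1 : Tendsto (fun n : ℕ => gridNext (2 ^ n) t) atTop (𝓝[>] t) := by
    have := (tendsto_gridNext t.coe_nonneg).comp (tendsto_pow_atTop_atTop_of_one_lt one_lt_two)
    rwa [Real.toNNReal_coe] at this
  rw [tendsto_nhdsWithin_iff] at h1 ⊢
  refine ⟨h1.1, h1.2.mono fun n hn => ⟨mem_iUnion.2 ⟨n, ⌊((2 ^ n : ℕ) : ℝ) * t⌋₊ + 1, ?_⟩, hn⟩⟩
  simp [gridNext]

lemma neBot_nhdsWithin_dyadics (t : ℝ≥0) : (𝓝[dyadics ∩ Ioi t] t).NeBot :=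
  (tendsto_gridNext_dyadics t).neBot

variable {E : Type*} [NormedAddCommGroup E]

lemma HasJumps.anti {ι : Type*} [LT ι] {f : ι → E} {r r' : ℝ} (hr : r' ≤ r) {A : Set ι} {p : ℕ}
    {s : ι} (h : HasJumps f r A p s) : HasJumps f r' A p s := by
  induction p generalizing s with
  | zero => exact h
  | succ p ih =>
    obtain ⟨hs, t, hst, hd, ht⟩ := h
    exact ⟨hs, t, hst, hr.trans_lt hd, ih ht⟩

lemma lt_norm_sub_or_of_two_mul_lt {r : ℝ} {x y : E} (h : 2 * r < ‖x - y‖) (z : E) :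
    r < ‖x - z‖ ∨ r < ‖y - z‖ := by
  by_contra! hcon
  have := norm_sub_le (x - z) (y - z)
  rw [sub_sub_sub_cancel_right] at this
  linarith [hcon.1, hcon.2]

/-- A function on the dyadics with finitely many jumps of each size on dyadic intervals. -/
def FiniteJumps (f : ℝ≥0 → E) : Prop :=
  ∀ r : ℝ, 0 < r → ∃ m : ℕ, ∀ j : ℕ, ∃ p : ℕ, ∀ s,
    ¬ HasJumps f r (dyadics ∩ Icc (j / 2 ^ m) ((j + 1 : ℕ) / 2 ^ m)) p s

variable {f : ℝ≥0 → E}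

/-- If every right neighbourhood of `t` had oscillation above `2 r`, a chain starting at `v > t`
could be extended backwards: of two points in `(t, v)` with values more than `2 r` apart, one has
value more than `r` from `f v`. Chains in one cell would then be arbitrarily long. -/
lemma FiniteJumps.exists_right (hf : FiniteJumps f) (t : ℝ≥0) {r : ℝ} (hr : 0 < r) :
    ∃ u, t < u ∧ ∀ s ∈ dyadics, ∀ s' ∈ dyadics, t < s → s < u → t < s' → s' < u →
      ‖f s - f s'‖ ≤ 2 * r := by
  by_contra! hcon
  obtain ⟨m, hm⟩ := hf r hr
  have h2 : (0 : ℝ≥0) < 2 ^ m := by positivity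
  set j := ⌊t * 2 ^ m⌋₊
  have hja : (j / 2 ^ m : ℝ≥0) ≤ t := by
    rw [div_le_iff₀ h2]; exact Nat.floor_le (by positivity)
  have hjb : t < ((j + 1 : ℕ) / 2 ^ m : ℝ≥0) := by
    rw [lt_div_iff₀ h2, Nat.cast_add, Nat.cast_one]; exact Nat.lt_floor_add_one _
  obtain ⟨p, hp⟩ := hm j
  suffices h : ∀ p, ∃ s, t < s ∧
      HasJumps f r (dyadics ∩ Icc (j / 2 ^ m) ((j + 1 : ℕ) / 2 ^ m)) p s by
    obtain ⟨s, -, hs⟩ := h p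
    exact hp s hs
  intro p
  induction p with
  | zero =>
    obtain ⟨s, hs, -, -, hts, hsu, -⟩ := hcon _ hjb
    exact ⟨s, hts, hs, hja.trans hts.le, hsu.le⟩
  | succ p ih =>
    obtain ⟨v, htv, hv⟩ := ih
    obtain ⟨s, hs, s', hs', hts, hsv, hts', hsv', hd⟩ := hcon v htv
    have hvb := hv.mem.2.2
    rcases lt_norm_sub_or_of_two_mul_lt hd (f v) with h | h
    · exact ⟨s, hts, ⟨hs, hja.trans hts.le, hsv.le.trans hvb⟩, v, hsv, by rwa [norm_sub_rev], hv⟩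
    · exact ⟨s', hts', ⟨hs', hja.trans hts'.le, hsv'.le.trans hvb⟩, v, hsv',
        by rwa [norm_sub_rev], hv⟩

/-- Here chains grow forwards towards `t`, so the induction covers every starting point of the cell
below `t`. The cell is found with a ceiling, to leave room on the left of `t`. -/
lemma FiniteJumps.exists_left (hf : FiniteJumps f) {t : ℝ≥0} (ht : 0 < t) {r : ℝ} (hr : 0 < r) :
    ∃ u, u < t ∧ ∀ s ∈ dyadics, ∀ s' ∈ dyadics, u < s → s < t → u < s' → s' < t →
      ‖f s - f s'‖ ≤ 2 * r := by
  by_contra! hcon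
  obtain ⟨m, hm⟩ := hf r hr
  have h2 : (0 : ℝ≥0) < 2 ^ m := by positivity
  have hc : 0 < ⌈t * 2 ^ m⌉₊ := Nat.ceil_pos.2 (by positivity)
  obtain ⟨j, hj⟩ := Nat.exists_eq_succ_of_ne_zero hc.ne'
  have hja : (j / 2 ^ m : ℝ≥0) < t := by
    rw [div_lt_iff₀ h2]; exact Nat.lt_ceil.1 (by omega)
  have hjb : t ≤ ((j + 1 : ℕ) / 2 ^ m : ℝ≥0) := by
    rw [le_div_iff₀ h2, ← Nat.succ_eq_add_one, ← hj]; exact Nat.le_ceil _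
  obtain ⟨p, hp⟩ := hm j
  suffices h : ∀ p, ∀ s ∈ dyadics, (j / 2 ^ m : ℝ≥0) ≤ s → s < t →
      HasJumps f r (dyadics ∩ Icc (j / 2 ^ m) ((j + 1 : ℕ) / 2 ^ m)) p s by
    obtain ⟨s, hs, -, -, hus, hst, -⟩ := hcon _ hja
    exact hp s (h p s hs hus.le hst)
  intro p
  induction p with
  | zero => exact fun s hs hjs hst => ⟨hs, hjs, hst.le.trans hjb⟩
  | succ p ih =>
    intro v hv hjv hvt
    obtain ⟨s, hs, s', hs', hts, hsv, hts', hsv', hd⟩ := hcon v hvt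
    refine ⟨⟨hv, hjv, hvt.le.trans hjb⟩, ?_⟩
    rcases lt_norm_sub_or_of_two_mul_lt hd (f v) with h | h
    · exact ⟨s, hts, h, ih s hs (hjv.trans hts.le) hsv⟩
    · exact ⟨s', hts', h, ih s' hs' (hjv.trans hts'.le) hsv'⟩

variable [CompleteSpace E]

lemma exists_tendsto_of_small_oscillation {l : Filter ℝ≥0}
    (h : ∀ r : ℝ, 0 < r → ∃ A ∈ l, ∀ s ∈ A, ∀ s' ∈ A, ‖f s - f s'‖ ≤ 2 * r) :
    ∃ x, Tendsto f l (𝓝 x) := by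
  rcases l.eq_or_neBot with rfl | hl
  · exact ⟨0, tendsto_bot⟩
  refine cauchy_map_iff_exists_tendsto.1 (Metric.cauchy_iff.2 ⟨inferInstance, fun ε hε => ?_⟩)
  obtain ⟨A, hA, hAr⟩ := h (ε / 4) (by positivity)
  refine ⟨f '' A, image_mem_map hA, ?_⟩
  rintro _ ⟨s, hs, rfl⟩ _ ⟨s', hs', rfl⟩
  rw [dist_eq_norm]
  linarith [hAr s hs s' hs']

/-- A function on the dyadics with finitely many jumps of each size has a càdlàg regularization. -/
lemma FiniteJumps.exists_cadlag (hf : FiniteJumps f) :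
    ∃ g : ℝ≥0 → E, (∀ t : ℝ≥0, Tendsto (fun n : ℕ => f (gridNext (2 ^ n) t)) atTop (𝓝 (g t))) ∧
      (∀ t, ContinuousWithinAt g (Ici t) t) ∧ ∀ t, ∃ l, Tendsto g (𝓝[<] t) (𝓝 l) := by
  have hright (t : ℝ≥0) : ∃ x, Tendsto f (𝓝[dyadics ∩ Ioi t] t) (𝓝 x) := by
    refine exists_tendsto_of_small_oscillation fun r hr => ?_
    obtain ⟨u, htu, hu⟩ := hf.exists_right t hr
    refine ⟨dyadics ∩ Ioi t ∩ Iio u, inter_mem_nhdsWithin _ (Iio_mem_nhds htu), ?_⟩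
    rintro s ⟨⟨hs, h1⟩, h2⟩ s' ⟨⟨hs', h1'⟩, h2'⟩
    exact hu s hs s' hs' h1 h2 h1' h2'
  have hleft (t : ℝ≥0) : ∃ x, Tendsto f (𝓝[dyadics ∩ Iio t] t) (𝓝 x) := by
    rcases eq_or_ne t 0 with rfl | ht
    · exact ⟨0, by simp⟩
    refine exists_tendsto_of_small_oscillation fun r hr => ?_
    obtain ⟨u, htu, hu⟩ := hf.exists_left (pos_iff_ne_zero.2 ht) hr
    refine ⟨dyadics ∩ Iio t ∩ Ioi u, inter_mem_nhdsWithin _ (Ioi_mem_nhds htu), ?_⟩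
    rintro s ⟨⟨hs, h1⟩, h2⟩ s' ⟨⟨hs', h1'⟩, h2'⟩
    exact hu s hs s' hs' h2 h1 h2' h1'
  choose g hg using hright
  -- Bounds valid at dyadic points pass to `g`, a limit of `f` along dyadics strictly to the right.
  have hclose {v : ℝ≥0} {x : E} {ε : ℝ} {B : Set ℝ≥0} (hB : B ∈ 𝓝 v)
      (h : ∀ s ∈ B, s ∈ dyadics → v < s → ‖f s - x‖ ≤ ε) : ‖g v - x‖ ≤ ε := by
    have := neBot_nhdsWithin_dyadics v
    refine le_of_tendsto ((hg v).sub_const x).norm ?_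
    filter_upwards [mem_nhdsWithin_of_mem_nhds hB, self_mem_nhdsWithin] with s hs hs'
    exact h s hs hs'.1 hs'.2
  refine ⟨g, fun t => (hg t).comp (tendsto_gridNext_dyadics t), fun t => ?_, fun t => ?_⟩
  · rw [← continuousWithinAt_Ioi_iff_Ici, ContinuousWithinAt, Metric.tendsto_nhds]
    intro ε hε
    have h1 := Metric.tendsto_nhds.1 (hg t) (ε / 2) (by positivity)
    rw [eventually_nhdsWithin_iff] at h1
    obtain ⟨u, htu, hu⟩ := exists_Ico_subset_of_mem_nhds h1 ⟨t + 1, lt_add_one t⟩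
    filter_upwards [Ioo_mem_nhdsGT htu] with v hv
    rw [dist_eq_norm]
    refine (hclose (ε := ε / 2) (Iio_mem_nhds hv.2) fun s hs hsd hvs => ?_).trans_lt (by linarith)
    rw [← dist_eq_norm]
    exact (hu ⟨(hv.1.trans hvs).le, hs⟩ ⟨hsd, hv.1.trans hvs⟩).le
  · obtain ⟨x, hx⟩ := hleft t
    refine ⟨x, ?_⟩
    rcases eq_or_ne t 0 with rfl | ht
    · simp
    rw [Metric.tendsto_nhds]
    intro ε hε
    have h1 := Metric.tendsto_nhds.1 hx (ε / 2) (by positivity)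
    rw [eventually_nhdsWithin_iff] at h1
    obtain ⟨u, htu, hu⟩ := exists_Ioc_subset_of_mem_nhds h1 ⟨0, pos_iff_ne_zero.2 ht⟩
    filter_upwards [Ioo_mem_nhdsLT htu] with v hv
    rw [dist_eq_norm]
    refine (hclose (ε := ε / 2) (Iio_mem_nhds hv.2) fun s hs hsd hvs => ?_).trans_lt (by linarith)
    rw [← dist_eq_norm]
    exact (hu ⟨hv.1.trans hvs, le_of_lt hs⟩ ⟨hsd, hs⟩).le

end Regularization

/-! ### From grid values to functions on the dyadics. -/

section DyadicPath

variable {E : Type*} [NormedAddCommGroup E]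

/-- Consistent values on the dyadic grids come from a function. -/
lemma exists_dyadic_path {W : ℕ → ℕ → E} (h : ∀ n k, W (n + 1) (2 * k) = W n k) :
    ∃ f : ℝ≥0 → E, ∀ n k : ℕ, f (k / 2 ^ n) = W n k := by
  classical
  have hiter (i n k : ℕ) : W (n + i) (2 ^ i * k) = W n k := by
    induction i with
    | zero => simp
    | succ i ih => rw [← add_assoc, pow_succ', mul_assoc, h, ih]
  refine ⟨fun s => if hs : ∃ z : ℕ × ℕ, s = z.2 / 2 ^ z.1 then W hs.choose.1 hs.choose.2 else 0,
    fun n k => ?_⟩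
  have hs : ∃ z : ℕ × ℕ, (k / 2 ^ n : ℝ≥0) = z.2 / 2 ^ z.1 := ⟨(n, k), rfl⟩
  simp only
  rw [dif_pos hs]
  have hz := hs.choose_spec
  rw [div_eq_div_iff (by positivity) (by positivity)] at hz
  have hz' : k * 2 ^ hs.choose.1 = hs.choose.2 * 2 ^ n := by exact_mod_cast hz
  -- The chosen representation of the point may be at another level; both are refined to the level
  -- that is the sum of the two.
  rw [← hiter n hs.choose.1 hs.choose.2, ← hiter hs.choose.1 n k, mul_comm, ← hz', mul_comm k,
    add_comm]

/-- Jumps of a function on a dyadic grid are jumps of the walk it induces. -/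
lemma HasJumps.of_dyadicGrid {f : ℝ≥0 → E} {r : ℝ} {n a N p : ℕ} {s : ℝ≥0}
    (h : HasJumps f r (dyadicGrid n ∩ Icc (a / 2 ^ n) ((a + N : ℕ) / 2 ^ n)) p s) :
    ∃ i : ℕ, s = (a + i : ℕ) / 2 ^ n ∧
      HasJumps (fun i : ℕ => f ((a + i : ℕ) / 2 ^ n)) r (Iic N) p i := by
  have h2 : (0 : ℝ≥0) < 2 ^ n := by positivity
  have hmem {s : ℝ≥0} (hs : s ∈ dyadicGrid n ∩ Icc (a / 2 ^ n : ℝ≥0) ((a + N : ℕ) / 2 ^ n)) :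
      ∃ i : ℕ, s = (a + i : ℕ) / 2 ^ n ∧ i ≤ N := by
    obtain ⟨⟨k, rfl⟩, h1, h3⟩ := hs
    rw [div_le_div_iff_of_pos_right h2] at h1 h3
    have h1' : a ≤ k := by exact_mod_cast h1
    have h3' : k ≤ a + N := by exact_mod_cast h3
    obtain ⟨i, rfl⟩ := Nat.exists_eq_add_of_le h1'
    exact ⟨i, rfl, by omega⟩
  induction p generalizing s with
  | zero =>
    obtain ⟨i, hi, hiN⟩ := hmem h
    exact ⟨i, hi, hiN⟩
  | succ p ih =>
    obtain ⟨hs, t, hst, hd, ht⟩ := h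
    obtain ⟨i, rfl, hiN⟩ := hmem hs
    obtain ⟨i', rfl, ht'⟩ := ih ht
    refine ⟨i, rfl, hiN, i', ?_, hd, ht'⟩
    rw [div_lt_div_iff_of_pos_right h2] at hst
    have : a + i < a + i' := by exact_mod_cast hst
    omega

end DyadicPath

/-! ### Laws of the rows of the array. -/

section Rows

variable {E : Type*} [MeasurableSpace E] {η : ℕ → Measure E} [∀ n, IsProbabilityMeasure (η n)]
  {P : Measure (ℕ → ℕ → E)}

lemma map_eval_of_rows (hlaw : ∀ n, P.map (fun ω => ω n) = Measure.infinitePi fun _ : ℕ => η n)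
    (n i : ℕ) : P.map (fun ω => ω n i) = η n := by
  rw [← Measure.infinitePi_map_eval (fun _ : ℕ => η n) i, ← hlaw,
    Measure.map_map (by fun_prop) (by fun_prop)]
  rfl

variable [IsProbabilityMeasure P]

lemma iIndepFun_of_rows (hlaw : ∀ n, P.map (fun ω => ω n) = Measure.infinitePi fun _ : ℕ => η n)
    (n : ℕ) : iIndepFun (fun i (ω : ℕ → ℕ → E) => ω n i) P := by
  rw [iIndepFun_iff_map_fun_eq_infinitePi_map (fun i => by fun_prop)]
  simp_rw [map_eval_of_rows hlaw]
  exact hlaw n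

lemma map_block_of_rows (hlaw : ∀ n, P.map (fun ω => ω n) = Measure.infinitePi fun _ : ℕ => η n)
    (n a N : ℕ) :
    P.map (fun ω (i : Fin N) => ω n (a + i)) = Measure.pi fun _ => η n := by
  have h := (iIndepFun_of_rows hlaw n).precomp (g := fun i : Fin N => a + (i : ℕ))
    (fun i j hij => by simpa [Fin.ext_iff] using hij)
  rw [iIndepFun_iff_map_fun_eq_pi_map (fun i => Measurable.aemeasurable (by fun_prop))] at h
  simpa only [map_eval_of_rows hlaw] using h

end Rows

/-! ### Almost sure finiteness of jumps. -/

section DyadicWalk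

open scoped ENNReal

variable {E : Type*} [NormedAddCommGroup E]

/-- The partial sums of the rows of an array. -/
def walk (ω : ℕ → ℕ → E) (n k : ℕ) : E := ∑ i ∈ Finset.range k, ω n i

lemma walk_sub_walk (ω : ℕ → ℕ → E) (n : ℕ) {a b : ℕ} (h : a ≤ b) :
    walk ω n b - walk ω n a = ∑ i ∈ Finset.Ico a b, ω n i :=
  (Finset.sum_Ico_eq_sub _ h).symm

lemma walk_succ_two_mul {ω : ℕ → ℕ → E}
    (h : ∀ n k, ω (n + 1) (2 * k) + ω (n + 1) (2 * k + 1) = ω n k) (n k : ℕ) :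
    walk ω (n + 1) (2 * k) = walk ω n k := by
  induction k with
  | zero => simp [walk]
  | succ k ih =>
    simp only [walk] at ih ⊢
    rw [show 2 * (k + 1) = 2 * k + 1 + 1 by ring, Finset.sum_range_succ, Finset.sum_range_succ,
      Finset.sum_range_succ, ih, add_assoc, h]

variable [SecondCountableTopology E] [MeasurableSpace E] [BorelSpace E]

lemma measurable_walk (n k : ℕ) : Measurable fun ω : ℕ → ℕ → E => walk ω n k :=
  Finset.measurable_sum _ fun i _ => by fun_prop

variable {η : ℕ → Measure E} [hη : ∀ n, IsProbabilityMeasure (η n)] {P : Measure (ℕ → ℕ → E)}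

variable [IsProbabilityMeasure P]

variable [NormedSpace ℝ E] [CompleteSpace E]

/-- A move of size `r` is a crossing at radius `r / 2`, whose tail is governed by end values beyond
`r / 4`. The bound does not depend on `n`, so it survives refinement of the grid. -/
lemma measure_hasJumps_dyadicGrid_le
    (hlaw : ∀ n, P.map (fun ω => ω n) = Measure.infinitePi fun _ : ℕ => η n)
    {f : (ℕ → ℕ → E) → ℝ≥0 → E} (hf : ∀ᵐ ω ∂P, ∀ n k : ℕ, f ω (k / 2 ^ n) = walk ω n k)
    {r : ℝ} (hr : 0 < r) {m : ℕ}
    (hm : ∀ n k : ℕ, k * 2 ^ m ≤ 2 ^ n → (convPow (η n) k).real {x | r / 4 < ‖x‖} ≤ 1 / 3)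
    {n : ℕ} (hn : m ≤ n) (j p : ℕ) :
    P {ω | ∃ s, HasJumps (f ω) r (dyadicGrid n ∩ Icc (j / 2 ^ m) ((j + 1 : ℕ) / 2 ^ m)) p s} ≤
      (1 / 2) ^ p := by
  obtain ⟨i, rfl⟩ := Nat.exists_eq_add_of_le hn
  set N := 2 ^ i
  set a := j * N
  have ha (j : ℕ) : (j / 2 ^ m : ℝ≥0) = (j * N : ℕ) / 2 ^ (m + i) := by
    rw [pow_add, Nat.cast_mul, Nat.cast_pow, Nat.cast_ofNat, mul_div_mul_right _ _ (by positivity)]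
  have hb : (j + 1) * N = a + N := by ring
  calc _ ≤ P {ω | Crosses (r / 2) N (fun l : Fin N => ω (m + i) (a + l)) 0 p} := by
        refine measure_mono_ae ?_
        filter_upwards [hf] with ω hω hs
        obtain ⟨s, hs⟩ := hs
        rw [ha, ha, hb] at hs
        obtain ⟨l, -, hl⟩ := hs.of_dyadicGrid
        rw [show r = 2 * (r / 2) by ring] at hl
        have hstep : (fun l : Fin N => ω (m + i) (a + l)) = fun l : Fin N =>
            f ω ((a + (l + 1) : ℕ) / 2 ^ (m + i)) - f ω ((a + l : ℕ) / 2 ^ (m + i)) := by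
          ext l
          rw [hω, hω, ← add_assoc, walk, walk, Finset.sum_range_succ, add_sub_cancel_left]
        show Crosses (r / 2) N (fun l : Fin N => ω (m + i) (a + l)) 0 p
        rw [hstep]
        exact hl.crosses (by positivity)
    _ = Measure.pi (fun _ : Fin N => η (m + i)) {x | Crosses (r / 2) N x 0 p} := by
        rw [← map_block_of_rows hlaw (m + i) a N,
          Measure.map_apply (by fun_prop) (measurableSet_crosses_right _ _ _ _)]
        rfl
    _ ≤ _ := by
        refine pi_crosses_le_pow _ (fun k hk => ?_) p
        rw [show r / 2 / 2 = r / 4 by ring]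
        refine hm _ _ ?_
        rw [pow_add, mul_comm]
        gcongr

/-- A chain has finitely many points, so one in the dyadics lies in a single grid, and the uniform
bound `2⁻ᵖ` passes to the increasing union over grids. Letting `p → ∞` excludes arbitrarily long
chains; the sizes `1 / (q + 1)` suffice. -/
lemma ae_finiteJumps
    (hlaw : ∀ n, P.map (fun ω => ω n) = Measure.infinitePi fun _ : ℕ => η n)
    {f : (ℕ → ℕ → E) → ℝ≥0 → E} (hf : ∀ᵐ ω ∂P, ∀ n k : ℕ, f ω (k / 2 ^ n) = walk ω n k)
    (hη : ∀ ε : ℝ, 0 < ε → ∃ m : ℕ, ∀ n k : ℕ, k * 2 ^ m ≤ 2 ^ n →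
      (convPow (η n) k).real {x | ε < ‖x‖} ≤ 1 / 3) :
    ∀ᵐ ω ∂P, FiniteJumps (f ω) := by
  have key (q : ℕ) : ∃ m : ℕ, ∀ j : ℕ, ∀ᵐ ω ∂P, ∃ p : ℕ, ∀ s, ¬ HasJumps (f ω) (1 / (q + 1 : ℝ))
      (dyadics ∩ Icc (j / 2 ^ m) ((j + 1 : ℕ) / 2 ^ m)) p s := by
    obtain ⟨m, hm⟩ := hη (1 / (q + 1 : ℝ) / 4) (by positivity)
    refine ⟨m, fun j => ?_⟩
    set I : Set ℝ≥0 := Icc (j / 2 ^ m) ((j + 1 : ℕ) / 2 ^ m)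
    have hle (p : ℕ) : P {ω | ∃ s, HasJumps (f ω) (1 / (q + 1 : ℝ)) (dyadics ∩ I) p s} ≤
        (1 / 2) ^ p := by
      have hmono : Monotone fun n => dyadicGrid n ∩ I := fun n n' h =>
        inter_subset_inter_left _ (monotone_dyadicGrid h)
      have hsub : {ω | ∃ s, HasJumps (f ω) (1 / (q + 1 : ℝ)) (dyadics ∩ I) p s} ⊆
          ⋃ n, {ω | ∃ s, HasJumps (f ω) (1 / (q + 1 : ℝ)) (dyadicGrid n ∩ I) p s} := by
        rintro ω ⟨s, hs⟩
        rw [dyadics, iUnion_inter] at hs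
        obtain ⟨n, hn⟩ := hs.exists_of_iUnion hmono
        exact mem_iUnion.2 ⟨n, s, hn⟩
      refine (measure_mono hsub).trans ?_
      rw [Monotone.measure_iUnion fun n n' h ω hω => hω.imp fun s hs => hs.mono (hmono h)]
      refine iSup_le fun n => ?_
      refine (measure_mono ?_).trans (measure_hasJumps_dyadicGrid_le hlaw hf (by positivity) hm
        (le_max_left m n) j p)
      rintro ω ⟨s, hs⟩
      exact ⟨s, hs.mono (hmono (le_max_right m n))⟩
    rw [ae_iff]
    refine le_antisymm (ge_of_tendsto'
      (ENNReal.tendsto_pow_atTop_nhds_zero_of_lt_one (r := 1 / 2) (by norm_num)) fun p => ?_)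
      zero_le
    refine (measure_mono fun ω hω => ?_).trans (hle p)
    simp only [mem_ofPred_eq] at hω
    push Not at hω
    exact hω p
  choose m hm using key
  have hall : ∀ᵐ ω ∂P, ∀ q j : ℕ, ∃ p : ℕ, ∀ s, ¬ HasJumps (f ω) (1 / (q + 1 : ℝ))
      (dyadics ∩ Icc (j / 2 ^ m q) ((j + 1 : ℕ) / 2 ^ m q)) p s :=
    ae_all_iff.2 fun q => ae_all_iff.2 fun j => hm q j
  filter_upwards [hall] with ω hω r hr
  obtain ⟨q, hq⟩ := exists_nat_one_div_lt hr
  refine ⟨m q, fun j => ?_⟩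
  obtain ⟨p, hp⟩ := hω q j
  exact ⟨p, fun s hs => hp s (hs.anti hq.le)⟩

end DyadicWalk

/-! ### Construction of the Lévy process. -/

section LevyExistence

variable {E : Type*} [NormedAddCommGroup E] [NormedSpace ℝ E] [SecondCountableTopology E]
  [MeasurableSpace E] [BorelSpace E]

/-- The index of the first dyadic point of level `n` after `t`. -/
noncomputable def gridIndex (n : ℕ) (t : ℝ≥0) : ℕ := ⌊((2 ^ n : ℕ) : ℝ) * t⌋₊ + 1

lemma gridNext_two_pow (n : ℕ) (t : ℝ≥0) : gridNext (2 ^ n) t = gridIndex n t / 2 ^ n := by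
  simp [gridNext, gridIndex]

lemma monotone_gridIndex (n : ℕ) : Monotone (gridIndex n) := fun s t h => by
  unfold gridIndex; gcongr

lemma tendsto_gridIndex_div (t : ℝ≥0) :
    Tendsto (fun n : ℕ => (gridIndex n t / 2 ^ n : ℝ)) atTop (𝓝 t) := by
  have := (tendsto_gridNext_dyadics t).mono_right nhdsWithin_le_nhds
  simpa [gridNext_two_pow] using NNReal.tendsto_coe.2 this

variable {η : ℕ → Measure E} [hη : ∀ n, IsProbabilityMeasure (η n)] {P : Measure (ℕ → ℕ → E)}
  [IsProbabilityMeasure P]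

/-- A walk increment is a sum of `b n - a n` independent steps of exponent `ψ / 2ⁿ`, so only the
limit of `(b n - a n) / 2ⁿ` matters. -/
lemma charFunDual_of_tendsto_walk {ψ : StrongDual ℝ E → ℂ}
    (hlaw : ∀ n, P.map (fun ω => ω n) = Measure.infinitePi fun _ : ℕ => η n)
    (hexp : ∀ n, IsExponent (η n) (fun L => ψ L / 2 ^ n)) {a b : ℕ → ℕ} (hab : ∀ n, a n ≤ b n)
    {c : ℝ} (hc : Tendsto (fun n => (b n / 2 ^ n - a n / 2 ^ n : ℝ)) atTop (𝓝 c))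
    {Z : (ℕ → ℕ → E) → E} (hZ : Measurable Z)
    (h : ∀ᵐ ω ∂P, Tendsto (fun n => walk ω n (b n) - walk ω n (a n)) atTop (𝓝 (Z ω)))
    (L : StrongDual ℝ E) : charFunDual (P.map Z) L = Complex.exp (c * ψ L) := by
  have h1 := tendsto_charFunDual_map (X := fun n ω => walk ω n (b n) - walk ω n (a n))
    (fun n => ((measurable_walk n (b n)).sub (measurable_walk n (a n))).aemeasurable)
    hZ.aemeasurable h L
  have h2 : Tendsto (fun n : ℕ => Complex.exp ((b n / 2 ^ n - a n / 2 ^ n : ℝ) * ψ L)) atTop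
      (𝓝 (Complex.exp (c * ψ L))) :=
    (Complex.continuous_exp.tendsto _).comp
      (((Complex.continuous_ofReal.tendsto c).comp hc).mul_const _)
  refine tendsto_nhds_unique h1 (h2.congr fun n => ?_)
  have hsum : (fun ω : ℕ → ℕ → E => walk ω n (b n) - walk ω n (a n)) =
      fun ω => ∑ i ∈ Finset.Ico (a n) (b n), ω n i :=
    funext fun ω => walk_sub_walk ω n (hab n)
  rw [hsum, iIndepFun.charFunDual_map_fun_finsetSum_eq_prod
    (X := fun i (ω : ℕ → ℕ → E) => ω n i)
    (fun i _ => Measurable.aemeasurable (by fun_prop)) ((iIndepFun_of_rows hlaw n).restrict _),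
    Finset.prod_apply]
  simp_rw [map_eval_of_rows hlaw, (hexp n).charFunDual_eq]
  rw [Finset.prod_const, Nat.card_Ico, ← Complex.exp_nat_mul, Nat.cast_sub (hab n)]
  push_cast
  congr 1
  ring

variable [CompleteSpace E]

lemma exists_cadlag_limit
    (hlaw : ∀ n, P.map (fun ω => ω n) = Measure.infinitePi fun _ : ℕ => η n)
    (hcons : ∀ᵐ ω ∂P, ∀ n k, ω (n + 1) (2 * k) + ω (n + 1) (2 * k + 1) = ω n k)
    (hη : ∀ ε : ℝ, 0 < ε → ∃ m : ℕ, ∀ n k : ℕ, k * 2 ^ m ≤ 2 ^ n →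
      (convPow (η n) k).real {x | ε < ‖x‖} ≤ 1 / 3) :
    ∃ Z : ℝ≥0 → (ℕ → ℕ → E) → E, (∀ t, Measurable (Z t)) ∧
      (∀ ω t, ContinuousWithinAt (fun s => Z s ω) (Ici t) t) ∧
      (∀ ω t, ∃ l, Tendsto (fun s => Z s ω) (𝓝[<] t) (𝓝 l)) ∧
      ∀ᵐ ω ∂P, ∀ t, Tendsto (fun n => walk ω n (gridIndex n t)) atTop (𝓝 (Z t ω)) := by
  have hpath : ∀ᵐ ω ∂P, ∃ f : ℝ≥0 → E, ∀ n k : ℕ, f (k / 2 ^ n) = walk ω n k :=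
    hcons.mono fun ω h => exists_dyadic_path (walk_succ_two_mul h)
  obtain ⟨f, hf⟩ := hpath.choice
  have hgood : ∀ᵐ ω ∂P, ∃ g : ℝ≥0 → E,
      (∀ t, Tendsto (fun n => walk ω n (gridIndex n t)) atTop (𝓝 (g t))) ∧
      (∀ t, ContinuousWithinAt g (Ici t) t) ∧ ∀ t, ∃ l, Tendsto g (𝓝[<] t) (𝓝 l) := by
    filter_upwards [hf, ae_finiteJumps hlaw hf hη] with ω hω hj
    obtain ⟨g, hg, h1, h2⟩ := hj.exists_cadlag
    refine ⟨g, fun t => ?_, h1, h2⟩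
    simpa only [gridNext_two_pow, hω] using hg t
  -- Off this measurable set of full measure the path is set to zero, so that path regularity holds
  -- for every `ω` and not just almost surely.
  obtain ⟨G, hG, hGm, hGg⟩ := hgood.exists_measurable_mem
  choose! g hg using hGg
  classical
  refine ⟨fun t => G.indicator fun ω => g ω t, fun t => ?_, fun ω t => ?_, fun ω t => ?_, ?_⟩
  · refine measurable_of_tendsto_metrizable
      (f := fun n => G.indicator fun ω => walk ω n (gridIndex n t))
      (fun n => (measurable_walk n _).indicator hGm) (tendsto_pi_nhds.2 fun ω => ?_)
    by_cases hω : ω ∈ G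
    · simpa [hω] using (hg ω hω).1 t
    · simp [hω]
  · by_cases hω : ω ∈ G
    · simpa [hω] using (hg ω hω).2.1 t
    · simpa [hω] using continuousWithinAt_const
  · by_cases hω : ω ∈ G
    · simpa [hω] using (hg ω hω).2.2 t
    · exact ⟨0, by simpa [hω] using tendsto_const_nhds⟩
  · filter_upwards [hG] with ω hω t
    simpa [hω] using (hg ω hω).1 t

/-- Independence is preserved by almost sure limits. -/
lemma iIndepFun_of_tendsto {Ω ι : Type*} [MeasurableSpace Ω] {P : Measure Ω}
    [IsProbabilityMeasure P] {X : ℕ → ι → Ω → E} {Z : ι → Ω → E}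
    (hX : ∀ n i, Measurable (X n i)) (hZ : ∀ i, Measurable (Z i))
    (hind : ∀ n, iIndepFun (X n) P)
    (h : ∀ i, ∀ᵐ ω ∂P, Tendsto (fun n => X n i ω) atTop (𝓝 (Z i ω))) : iIndepFun Z P := by
  classical
  refine iIndepFun_iff_finset.2 fun s => ?_
  refine (iIndepFun_iff_charFunDual_pi fun i : s => (hZ i).aemeasurable).2 fun L => ?_
  have h1 := tendsto_charFunDual_map (P := P) (X := fun n ω (i : s) => X n i ω)
    (Z := fun ω (i : s) => Z i ω) (fun n => (measurable_pi_iff.2 fun i : s => hX n i).aemeasurable)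
    (measurable_pi_iff.2 fun i : s => hZ i).aemeasurable
    ((ae_all_iff.2 fun i : s => h i).mono fun ω hω => tendsto_pi_nhds.2 hω) L
  have h2 := tendsto_finsetProd (Finset.univ : Finset s) fun i _ =>
    tendsto_charFunDual_map (fun n => (hX n i).aemeasurable) (hZ i).aemeasurable (h i)
      (L.comp (.single ℝ (fun _ : s => E) i))
  refine tendsto_nhds_unique h1 (h2.congr fun n => ?_)
  exact ((iIndepFun_iff_charFunDual_pi fun i : s => (hX n i).aemeasurable).1
    ((iIndepFun_iff_finset.1 (hind n)) s) L).symm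

lemma ae_eq_zero_of_charFunDual_eq_one {Ω : Type*} [MeasurableSpace Ω] {P : Measure Ω}
    [IsProbabilityMeasure P] {Z : Ω → E} (hZ : Measurable Z)
    (h : ∀ L, charFunDual (P.map Z) L = 1) : ∀ᵐ ω ∂P, Z ω = 0 := by
  have : IsProbabilityMeasure (P.map Z) := Measure.isProbabilityMeasure_map hZ.aemeasurable
  have h0 : P.map Z = Measure.dirac 0 := Measure.ext_of_charFunDual (by ext L; simp [h L])
  refine ae_of_ae_map hZ.aemeasurable (p := fun x => x = 0) ?_
  rw [h0]
  exact (ae_dirac_iff (measurableSet_singleton 0)).2 rfl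

/-- Every infinitely divisible law is the law at time `1` of a Lévy process. -/
lemma exists_levyProcess {E : Type u} [NormedAddCommGroup E] [NormedSpace ℝ E] [CompleteSpace E]
    [SecondCountableTopology E] [MeasurableSpace E] [BorelSpace E] {ν : Measure E}
    (hν : ν ∈ ID E) :
    ∃ (Ω : Type u) (_ : MeasurableSpace Ω) (P : Measure Ω) (_ : IsProbabilityMeasure P)
      (Y : ℝ≥0 → Ω → E), IsLevyProcess Y P ∧ P.map (Y 1) = ν := by
  have hprob : IsProbabilityMeasure ν := hν.1
  obtain ⟨ψ, hψ⟩ := exists_isExponent_of_mem_ID hν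
  choose η hηp hη using fun n : ℕ => hν.2 (2 ^ n) Nat.one_le_two_pow
  have hexp (n : ℕ) : IsExponent (η n) (fun L => ψ L / 2 ^ n) := by
    simpa using hψ.of_convPow (pow_ne_zero n two_ne_zero) (hη n)
  have hsq (n : ℕ) : η (n + 1) ∗ η (n + 1) = η n := by
    refine IsExponent.measure_ext ((hexp (n + 1)).conv (hexp (n + 1))) ?_
    convert hexp n using 2 with L
    rw [pow_succ]
    ring
  have h0 : η 0 = ν := by
    have := hη 0
    rwa [pow_zero, convPow_one] at this
  have htail (ε : ℝ) (hε : 0 < ε) : ∃ m : ℕ, ∀ n k : ℕ, k * 2 ^ m ≤ 2 ^ n →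
      (convPow (η n) k).real {x | ε < ‖x‖} ≤ 1 / 3 := by
    obtain ⟨δ, hδ, h⟩ := exists_norm_tail_le hψ hsq h0 hexp hε (show (0 : ℝ) < 1 / 3 by norm_num)
    obtain ⟨m, hm⟩ := exists_pow_lt_of_lt_one hδ (show (1 / 2 : ℝ) < 1 by norm_num)
    refine ⟨m, fun n k hk => h n k ?_⟩
    have hk' : (k * 2 ^ m : ℝ) ≤ 2 ^ n := by exact_mod_cast hk
    calc (k : ℝ) = (1 / 2) ^ m * (k * 2 ^ m) := by
          rw [mul_comm (k : ℝ), ← mul_assoc, ← mul_pow]; norm_num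
      _ ≤ δ * 2 ^ n := by gcongr
  obtain ⟨P, hP, hlaw, hcons⟩ := exists_dyadic_walks hsq
  obtain ⟨Z, hZm, hZr, hZl, hZ⟩ := exists_cadlag_limit hlaw hcons htail
  -- `Z 0` is a limit of values strictly to the right of `0`, so it vanishes only almost surely; a
  -- second modification makes this hold everywhere.
  have hZ0 : ∀ᵐ ω ∂P, Z 0 ω = 0 := by
    refine ae_eq_zero_of_charFunDual_eq_one (hZm 0) fun L => ?_
    rw [charFunDual_of_tendsto_walk hlaw hexp (a := fun _ => 0) (fun n => Nat.zero_le _)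
      (by simpa using tendsto_gridIndex_div 0) (hZm 0)
      (hZ.mono fun ω hω => by simpa [walk] using hω 0)]
    simp
  set G : Set (ℕ → ℕ → E) := {ω | Z 0 ω = 0}
  have hGm : MeasurableSet G := measurableSet_eq_fun (hZm 0) measurable_const
  set Y : ℝ≥0 → (ℕ → ℕ → E) → E := fun t => G.indicator (Z t)
  have hYm (t : ℝ≥0) : Measurable (Y t) := (hZm t).indicator hGm
  have hY0 (ω : ℕ → ℕ → E) : Y 0 ω = 0 := by
    by_cases hω : ω ∈ G
    · exact (indicator_of_mem hω _).trans hω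
    · exact indicator_of_notMem hω _
  have hY : ∀ᵐ ω ∂P, ∀ t, Tendsto (fun n => walk ω n (gridIndex n t)) atTop (𝓝 (Y t ω)) := by
    filter_upwards [hZ, hZ0] with ω hω hω0 t
    have : ω ∈ G := hω0
    simpa [Y, this] using hω t
  have hchar (s t : ℝ≥0) (hst : s ≤ t) (L : StrongDual ℝ E) :
      charFunDual (P.map fun ω => Y t ω - Y s ω) L = Complex.exp ((t - s : ℝ) * ψ L) :=
    charFunDual_of_tendsto_walk hlaw hexp (fun n => monotone_gridIndex n hst)
      ((tendsto_gridIndex_div t).sub (tendsto_gridIndex_div s)) ((hYm t).sub (hYm s))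
      (hY.mono fun ω hω => (hω t).sub (hω s)) L
  have hchar0 (t : ℝ≥0) (L : StrongDual ℝ E) :
      charFunDual (P.map (Y t)) L = Complex.exp (t * ψ L) := by
    simpa [hY0] using hchar 0 t zero_le L
  have hprobY (t : ℝ≥0) : IsProbabilityMeasure (P.map (Y t)) :=
    Measure.isProbabilityMeasure_map (hYm t).aemeasurable
  -- The sample space lies in the universe of `E`, as `IsJLaw` demands.
  refine ⟨ℕ → ℕ → E, inferInstance, P, hP, Y, ⟨hYm, hY0, ?_, fun s t => ?_, fun ω t => ?_,
    fun ω t => ?_⟩, Measure.ext_of_charFunDual ?_⟩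
  · refine HasIndepIncrements.of_nat fun t ht _ => ?_
    refine iIndepFun_of_tendsto
      (X := fun n i ω => ∑ j ∈ Finset.Ico (gridIndex n (t i)) (gridIndex n (t (i + 1))), ω n j)
      (fun n i => by fun_prop) (fun i => (hYm _).sub (hYm _)) (fun n => ?_) fun i => ?_
    · exact (iIndepFun_of_rows hlaw n).sum_Ico (fun i => by fun_prop)
        (t := fun i => gridIndex n (t i)) ((monotone_gridIndex n).comp ht)
    · filter_upwards [hY] with ω hω
      refine ((hω (t (i + 1))).sub (hω (t i))).congr fun n => ?_
      exact walk_sub_walk ω n (monotone_gridIndex n (ht i.le_succ))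
  · have : IsProbabilityMeasure (P.map fun ω => Y (s + t) ω - Y s ω) :=
      Measure.isProbabilityMeasure_map ((hYm _).sub (hYm _)).aemeasurable
    refine Measure.ext_of_charFunDual ?_
    ext L
    rw [hchar _ _ le_self_add, hchar0]
    simp
  · by_cases hω : ω ∈ G
    · simpa [Y, hω] using hZr ω t
    · simpa [Y, hω] using continuousWithinAt_const
  · by_cases hω : ω ∈ G
    · simpa [Y, hω] using hZl ω t
    · exact ⟨0, by simpa [Y, hω] using tendsto_const_nhds⟩
  · ext L
    rw [hchar0, hψ.charFunDual_eq]
    simp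

end LevyExistence

/-! ### Properties of `J` on `ID` and the factorization. -/

section Main

variable {E : Type u} [NormedAddCommGroup E] [NormedSpace ℝ E] [CompleteSpace E]
  [SecondCountableTopology E] [MeasurableSpace E] [BorelSpace E]

lemma isExponent_J {ν : Measure E} (hν : ν ∈ ID E) {ψ : StrongDual ℝ E → ℂ}
    (hψ : IsExponent ν ψ) {β : ℝ} (hβ : 0 < β) :
    IsExponent (J β ν) (fun L => ∫ t in (0 : ℝ)..1, ψ (t ^ (1 / β) • L)) :=
  (J_spec_of_exists hψ (exists_levyProcess hν) hβ).2

lemma isProbabilityMeasure_J {ν : Measure E} (hν : ν ∈ ID E) {β : ℝ} (hβ : 0 < β) :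
    IsProbabilityMeasure (J β ν) :=
  have ⟨_, hψ⟩ := exists_isExponent_of_mem_ID hν
  (J_spec_of_exists hψ (exists_levyProcess hν) hβ).1

/-- `J β` acts linearly on exponents, so it maps `n`-th roots to `n`-th roots. -/
lemma J_mem_ID {ν : Measure E} (hν : ν ∈ ID E) {β : ℝ} (hβ : 0 < β) : J β ν ∈ ID E := by
  have := isProbabilityMeasure_J hν hβ
  refine ⟨this, fun n hn => ?_⟩
  obtain ⟨η, hη, hην⟩ := hν.2 n hn
  have hn' : n ≠ 0 := by omega
  have hηID := mem_ID_of_convPow_eq hν hn' hην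
  obtain ⟨ψ, hψ⟩ := exists_isExponent_of_mem_ID hηID
  have := isProbabilityMeasure_J hηID hβ
  refine ⟨J β η, this, ((isExponent_J hηID hψ hβ).convPow n).measure_ext ?_⟩
  have h2 := isExponent_J hν (hην ▸ hψ.convPow n) hβ
  simpa only [intervalIntegral.integral_const_mul] using h2

lemma map_randomIntegral_eq_J {ν : Measure E} (hν : ν ∈ ID E) {β : ℝ} (hβ : 0 < β)
    {Ω : Type*} [MeasurableSpace Ω] {P : Measure Ω} [IsProbabilityMeasure P] {Y : ℝ≥0 → Ω → E}
    (hY : IsLevyProcess Y P) (hYν : P.map (Y 1) = ν) :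
    P.map (randomIntegral (fun t => t ^ (1 / β)) Y) = J β ν := by
  obtain ⟨ψ, hψ⟩ := exists_isExponent_of_mem_ID hν
  obtain ⟨hm, he⟩ := hY.isExponent_randomIntegral_rpow (hYν ▸ hψ) hβ
  have := isProbabilityMeasure_J hν hβ
  have := Measure.isProbabilityMeasure_map (μ := P) hm.aemeasurable
  exact he.measure_ext (isExponent_J hν hψ hβ)

lemma J_conv {μ ν : Measure E} (hμ : μ ∈ ID E) (hν : ν ∈ ID E) (hμν : μ ∗ ν ∈ ID E) {β : ℝ}
    (hβ : 0 < β) : J β (μ ∗ ν) = J β μ ∗ J β ν := by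
  have := hμ.1
  have := hν.1
  have := isProbabilityMeasure_J hμ hβ
  have := isProbabilityMeasure_J hν hβ
  have := isProbabilityMeasure_J hμν hβ
  obtain ⟨ψ, hψ⟩ := exists_isExponent_of_mem_ID hμ
  obtain ⟨φ, hφ⟩ := exists_isExponent_of_mem_ID hν
  refine (isExponent_J hμν (hψ.conv hφ) hβ).measure_ext ?_
  convert (isExponent_J hμ hψ hβ).conv (isExponent_J hν hφ hβ) using 2 with L
  have hc : Continuous fun t : ℝ => t ^ (1 / β) := Real.continuous_rpow_const (by positivity)
  exact intervalIntegral.integral_add (((hψ.cont L).comp hc).intervalIntegrable _ _)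
    (((hφ.cont L).comp hc).intervalIntegrable _ _)

/-- By Fubini, both exponents are the double integral of `ψ ((√t s) • L)`. -/
lemma J_one_J_two_comm {ν : Measure E} (hν : ν ∈ ID E) : J 1 (J 2 ν) = J 2 (J 1 ν) := by
  have h1 := J_mem_ID hν one_pos
  have h2 := J_mem_ID hν two_pos
  have := isProbabilityMeasure_J h1 two_pos
  have := isProbabilityMeasure_J h2 one_pos
  obtain ⟨ψ, hψ⟩ := exists_isExponent_of_mem_ID hν
  refine (isExponent_J h2 (isExponent_J hν hψ two_pos) one_pos).measure_ext ?_
  convert isExponent_J h1 (isExponent_J hν hψ one_pos) two_pos using 2 with L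
  have hc : Continuous fun t : ℝ => t ^ (1 / 2 : ℝ) := Real.continuous_rpow_const (by norm_num)
  have hcont : Continuous (Function.uncurry fun s t : ℝ => ψ ((t ^ (1 / 2 : ℝ) * s) • L)) :=
    (hψ.cont L).comp (by fun_prop : Continuous fun p : ℝ × ℝ => p.2 ^ (1 / 2 : ℝ) * p.1)
  simp only [smul_smul, ne_eq, one_ne_zero, not_false_eq_true, div_self, Real.rpow_one]
  rw [intervalIntegral_intervalIntegral_swap (F := fun s t : ℝ => ψ ((t ^ (1 / 2 : ℝ) * s) • L)) (by
    exact (hcont.continuousOn.integrableOn_compact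
      (isCompact_uIcc.prod isCompact_uIcc)).mono_set
        (prod_mono uIoc_subset_uIcc uIoc_subset_uIcc))]
  refine intervalIntegral.integral_congr fun t _ => intervalIntegral.integral_congr fun s _ => ?_
  simp only [mul_comm]

/-- The factorization identity `𝒥(ρ) ∗ ρ = 𝒥(ν)` for `ρ = 𝒥²(ν^{*1/2})`. -/
lemma J_one_conv_self {ν : Measure E} (hν : ν ∈ ID E) :
    J 1 (J 2 (convHalf ν)) ∗ J 2 (convHalf ν) = J 1 ν := by
  obtain ⟨hh, hc, -⟩ := convHalf_spec hν
  have := hh.1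
  have h2 := J_mem_ID hh two_pos
  have := isProbabilityMeasure_J h2 one_pos
  have := isProbabilityMeasure_J hh two_pos
  have := isProbabilityMeasure_J hν one_pos
  obtain ⟨ψ, hψ⟩ := exists_isExponent_of_mem_ID hh
  have hJ := isExponent_J hh hψ two_pos
  refine ((isExponent_J h2 hJ one_pos).conv hJ).measure_ext ?_
  convert isExponent_J hν (hc ▸ hψ.conv hψ) one_pos using 2 with L
  have := integral_integral_sqrt_add (hψ.cont L)
  simp only [smul_smul, ne_eq, one_ne_zero, not_false_eq_true, div_self, Real.rpow_one]
  rw [this, ← intervalIntegral.integral_const_mul]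
  refine intervalIntegral.integral_congr fun t _ => ?_
  ring

/-- `ρ` is determined by `𝒥(ρ) ∗ ρ`. -/
lemma eq_of_J_one_conv_eq {ρ σ : Measure E} (hρ : ρ ∈ ID E) (hσ : σ ∈ ID E)
    (h : J 1 ρ ∗ ρ = J 1 σ ∗ σ) : ρ = σ := by
  have := hρ.1
  have := hσ.1
  have := isProbabilityMeasure_J hρ one_pos
  have := isProbabilityMeasure_J hσ one_pos
  obtain ⟨ψ, hψ⟩ := exists_isExponent_of_mem_ID hρ
  obtain ⟨φ, hφ⟩ := exists_isExponent_of_mem_ID hσ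
  have h1 := (isExponent_J hρ hψ one_pos).conv hψ
  have h2 := (isExponent_J hσ hφ one_pos).conv hφ
  have heq := h1.unique (h ▸ h2)
  suffices hs : ψ = φ by subst hs; exact hψ.measure_ext hφ
  ext L
  -- The equality of exponents is used on the whole line through `L`, where it says that averaging
  -- plus identity kills the difference.
  have hd := eq_zero_of_integral_add_eq_zero (d := fun s => ψ (s • L) - φ (s • L))
    ((hψ.cont L).sub (hφ.cont L)) fun s => by
      have h3 := congrFun heq (s • L)
      simp only [smul_smul, ne_eq, one_ne_zero, not_false_eq_true, div_self, Real.rpow_one] at h3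
      have hs : Continuous fun t : ℝ => t * s := by fun_prop
      have h4 := intervalIntegral.integral_sub (a := 0) (b := 1) (μ := volume)
        (((hψ.cont L).comp hs).intervalIntegrable _ _)
        (((hφ.cont L).comp hs).intervalIntegrable _ _)
      simp only [Function.comp_def] at h4
      rw [h4]
      linear_combination h3
  simpa [sub_eq_zero] using hd

end Main

theorem corollary2 {E : Type u} [NormedAddCommGroup E] [NormedSpace ℝ E] [CompleteSpace E]
    [SecondCountableTopology E] [MeasurableSpace E] [BorelSpace E] :
    -- the mappings `𝒥^β` and `ν ↦ ν^{*1/2}` are well defined on `ID`, with values in `ID`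
    (∀ β : ℝ, 0 < β → ∀ ν ∈ ID E, J β ν ∈ ID E ∧
      ∀ (Ω : Type u) [MeasurableSpace Ω] (P : Measure Ω) [IsProbabilityMeasure P]
        (Y : ℝ≥0 → Ω → E), IsLevyProcess Y P → P.map (Y 1) = ν →
          P.map (randomIntegral (fun t => t ^ (1 / β)) Y) = J β ν) ∧
    (∀ ν ∈ ID E, convHalf ν ∈ ID E ∧ convHalf ν ∗ convHalf ν = ν ∧
      ∀ η : Measure E, IsProbabilityMeasure η → η ∗ η = ν → η = convHalf ν) ∧
    -- the factorization property
    (∀ ρ ∈ ID E, J 1 ρ ∗ ρ ∈ classU E 1 ↔ ρ ∈ classU E 2) ∧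
    classUf E 1 = J 2 '' classU E 1 ∧
    (∀ ρ ∈ ID E, ∀ ν ∈ ID E, J 1 ρ ∗ ρ = J 1 ν ↔ ρ = J 2 (convHalf ν)) ∧
    -- every s-selfdecomposable law factors uniquely
    (∀ μ ∈ classU E 1, ∃ ρ ∈ classU E 2, μ = J 1 ρ ∗ ρ ∧ J 2 μ = J 1 (ρ ∗ ρ) ∧
      ∀ ρ' ∈ classU E 2, μ = J 1 ρ' ∗ ρ' → ρ' = ρ) ∧
    classU E 1 = {μ | ∃ ρ ∈ classU E 2, μ = J 1 ρ ∗ ρ} := by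
  have hhalf (ν : Measure E) (hν : ν ∈ ID E) := convHalf_spec hν
  have hfac (ρ : Measure E) (hρ : ρ ∈ ID E) (ν : Measure E) (hν : ν ∈ ID E) :
      J 1 ρ ∗ ρ = J 1 ν ↔ ρ = J 2 (convHalf ν) := by
    refine ⟨fun h => ?_, fun h => by rw [h, J_one_conv_self hν]⟩
    exact eq_of_J_one_conv_eq hρ (J_mem_ID (hhalf ν hν).1 two_pos)
      (by rw [h, J_one_conv_self hν])
  -- every element of `𝒰₂` is of the form `𝒥²(ν^{*1/2})`
  have hdouble (σ : Measure E) (hσ : σ ∈ ID E) : σ ∗ σ ∈ ID E ∧ convHalf (σ ∗ σ) = σ := by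
    have := hσ.1
    have hID : σ ∗ σ ∈ ID E := by
      refine ⟨inferInstance, fun n hn => ?_⟩
      obtain ⟨η, hη, hησ⟩ := hσ.2 n hn
      refine ⟨convPow η 2, inferInstance, ?_⟩
      rw [← convPow_mul, mul_comm, convPow_mul, hησ, convPow_two]
    exact ⟨hID, ((hhalf _ hID).2.2 σ hσ.1 rfl).symm⟩
  have hiff (ρ : Measure E) (hρ : ρ ∈ ID E) : J 1 ρ ∗ ρ ∈ classU E 1 ↔ ρ ∈ classU E 2 := by
    constructor
    · rintro ⟨ν, hν, h⟩
      exact ⟨convHalf ν, (hhalf ν hν).1, ((hfac ρ hρ ν hν).1 h.symm).symm⟩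
    · rintro ⟨σ, hσ, rfl⟩
      obtain ⟨hID, hc⟩ := hdouble σ hσ
      exact ⟨σ ∗ σ, hID, ((hfac _ hρ _ hID).2 (by rw [hc])).symm⟩
  refine ⟨fun β hβ ν hν => ⟨J_mem_ID hν hβ,
    fun Ω _ P _ Y hY h => map_randomIntegral_eq_J hν hβ hY h⟩, hhalf, hiff, ?_, hfac, ?_, ?_⟩
  · ext μ
    constructor
    · rintro ⟨ρ, hρ, rfl, h⟩
      obtain ⟨σ, hσ, rfl⟩ := (hiff ρ hρ).1 h
      exact ⟨J 1 σ, ⟨σ, hσ, rfl⟩, (J_one_J_two_comm hσ).symm⟩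
    · rintro ⟨_, ⟨σ, hσ, rfl⟩, rfl⟩
      have h2 := J_mem_ID hσ two_pos
      exact ⟨J 2 σ, h2, (J_one_J_two_comm hσ).symm, (hiff _ h2).2 ⟨σ, hσ, rfl⟩⟩
  · rintro _ ⟨ν, hν, rfl⟩
    obtain ⟨hh, hc, -⟩ := hhalf ν hν
    have h2 := J_mem_ID hh two_pos
    refine ⟨J 2 (convHalf ν), ⟨_, hh, rfl⟩, (J_one_conv_self hν).symm, ?_, ?_⟩
    · rw [← J_one_J_two_comm hν, ← J_conv hh hh (hc.symm ▸ hν) two_pos, hc]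
    · rintro _ ⟨σ, hσ, rfl⟩ h
      exact (hfac _ (J_mem_ID hσ two_pos) ν hν).1 h.symm
  · ext μ
    constructor
    · rintro ⟨ν, hν, rfl⟩
      exact ⟨_, ⟨_, (hhalf ν hν).1, rfl⟩, (J_one_conv_self hν).symm⟩
    · rintro ⟨_, ⟨σ, hσ, rfl⟩, rfl⟩
      exact (hiff _ (J_mem_ID hσ two_pos)).2 ⟨σ, hσ, rfl⟩
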